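/- **Theorem (Uniform geometric ergodicity for the projective Markov chain).** Let $\mathbb S^1=\mathbb R/2\pi\mathbb Z$ and $\mathbb T^3=(\mathbb S^1)^3$. Let $f_1,f_2,f_3\in C^\omega(\mathbb S^1,\mathbb R)$ be non-constant functions such that, for $i=1,2,3$, $f_i$ and $f_i'$ have no common zero and $f_i'$ and $f_i''$ have no common zero. Consider on $\mathbb T^3$ the vector fields $$X_1(x)=(f_1(x_3),f_1'(x_3),0),\quad X_2(x)=(0,f_2(x_1),f_2'(x_1)),\quad X_3(x)=(f_3'(x_2),0,f_3(x_2)),$$ with flows $\varphi^{(i)}_t(x)=x+tX_i(x)$ (mod $2\pi$). Fix $h>0$, let $\tau=(\tau_1,\tau_2,\tau_3)$ be independent exponential random variables with mean $h$, and put $\Phi_\tau=\varphi^{(3)}_{\tau_3}\circ\varphi^{(2)}_{\tau_2}\circ\varphi^{(1)}_{\tau_1}$. The projective chain is the Markov chain on the unit sphere bundle $S\mathbb T^3=\{(x,u):x\in\mathbb T^3,\ u\in\mathbb R^3,\ |u|=1\}$ with transition kernel $$\check P((x,u),A)=\mathbb P\big(\check\Phi_\tau(x,u)\in A\big),\qquad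 \check\Phi_\tau(x,u)=\Big(\Phi_\tau(x),\ \frac{D_x\Phi_\tau u}{|D_x\Phi_\tau u|}\Big),$$ for Borel sets $A\subset S\mathbb T^3$. It acts on functions by $\check Pg(z)=\int g(w)\,\check P(z,dw)$. Then $\check P$ is uniformly geometrically ergodic: there is a unique probability measure $\check\mu$ on $S\mathbb T^3$ with $\int \check P(z,\cdot)\,\check\mu(dz)=\check\mu$, and there are constants $C>0$ and $\gamma\in(0,1)$ such that $$\Big|\check P^m g(z)-\int g\,d\check\mu\Big|\le C\,\gamma^m\,\sup_{w\in S\mathbb T^3}|g(w)|$$ for all $m\in\mathbb N$, all $z\in S\mathbb T^3$ and all bounded measurable $g:S\mathbb T^3\to\mathbb R$. -/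

import Mathlib

open Real MeasureTheory ProbabilityTheory Set

namespace RandomSplitting

noncomputable section

instance factTwoPiPos : Fact (0 < 2 * π) := ⟨Real.two_pi_pos⟩

/-- The circle `ℝ / 2πℤ`. -/
abbrev S1 : Type := AddCircle (2 * π)

/-- The torus `𝕋³ = (ℝ / 2πℤ)³`; coordinates are numbered `0, 1, 2`. -/
abbrev T3 : Type := Fin 3 → S1

/-- Euclidean space `ℝ³`, the tangent space of the torus at each of its points. -/
abbrev E3 : Type := EuclideanSpace ℝ (Fin 3)

/-- The unit sphere bundle of the (flat) torus: points `(x, u)` with `x ∈ 𝕋³` and `|u| = 1`. -/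
abbrev ST3 : Type := T3 × Metric.sphere (0 : E3) 1

/-- The covering map `ℝ³ → 𝕋³`. -/
def proj (v : E3) : T3 := fun i => (v i : S1)

/-- The branch of the inverse of `proj` with coordinates in `(-π, π]`. -/
def torusLog (x : T3) : E3 :=
  WithLp.toLp 2 fun i => (AddCircle.equivIoc (2 * π) (-π) (x i) : ℝ)

/-- The derivative of a function on the circle. -/
def circleDeriv (g : S1 → ℝ) (θ : S1) : ℝ := deriv (fun s : ℝ => g (θ + (s : S1))) 0

/-- `g ∈ C^ω(𝕊¹, ℝ)`: the `2π`-periodic function `s ↦ g (s mod 2π)` is real analytic on `ℝ`. -/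
def IsAnalyticOnCircle (g : S1 → ℝ) : Prop :=
  AnalyticOnNhd ℝ (fun s : ℝ => g (s : S1)) univ

/-- The zero set `C_g`. -/
def zeroSet (g : S1 → ℝ) : Set S1 := {θ | g θ = 0}

/-- Condition (H1): `C_{fᵢ} ∩ C_{fᵢ'} = ∅` and `C_{fᵢ'} ∩ C_{fᵢ''} = ∅` for `i = 1, 2, 3`. -/
def H1 (f : Fin 3 → S1 → ℝ) : Prop :=
  ∀ i, zeroSet (f i) ∩ zeroSet (circleDeriv (f i)) = ∅ ∧
    zeroSet (circleDeriv (f i)) ∩ zeroSet (circleDeriv (circleDeriv (f i))) = ∅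

/-- The vector fields `X₁(x) = (f₁(x₃), f₁'(x₃), 0)`, `X₂(x) = (0, f₂(x₁), f₂'(x₁))`,
`X₃(x) = (f₃'(x₂), 0, f₃(x₂))`. -/
def vectorField (f : Fin 3 → S1 → ℝ) : Fin 3 → T3 → E3
  | 0, x => !₂[f 0 (x 2), circleDeriv (f 0) (x 2), 0]
  | 1, x => !₂[0, f 1 (x 0), circleDeriv (f 1) (x 0)]
  | 2, x => !₂[circleDeriv (f 2) (x 1), 0, f 2 (x 1)]

/-- The flow `φ_t^{(i)}` of `ẋ = Xᵢ(x)`. As `Xᵢ` is constant along its own integral curves, the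
flow is `φ_t^{(i)}(x) = x + t Xᵢ(x)` modulo `2π`. -/
def flow (f : Fin 3 → S1 → ℝ) (i : Fin 3) (t : ℝ) (x : T3) : T3 :=
  x + proj (t • vectorField f i x)

/-- One step `Φ_τ = φ_{τ₃}^{(3)} ∘ φ_{τ₂}^{(2)} ∘ φ_{τ₁}^{(1)}` of the one-point chain. -/
def step (f : Fin 3 → S1 → ℝ) (τ : Fin 3 → ℝ) (x : T3) : T3 :=
  flow f 2 (τ 2) (flow f 1 (τ 1) (flow f 0 (τ 0) x))

/-- The differential `D_x F : T_x𝕋³ → T_{F(x)}𝕋³` of a map `F : 𝕋³ → 𝕋³`, computed in the charts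
`v ↦ x + proj v` at `x` and `y ↦ torusLog (y - F x)` at `F x`. -/
def torusFDeriv (F : T3 → T3) (x : T3) : E3 →L[ℝ] E3 :=
  fderiv ℝ (fun v : E3 => torusLog (F (x + proj v) - F x)) 0

/-- The normalisation `w / |w|` of a nonzero vector. The value `u` for `w = 0` is a convention:
it is never used below, because the differential of a diffeomorphism is injective. -/
def normalizeOr (u : Metric.sphere (0 : E3) 1) (w : E3) : Metric.sphere (0 : E3) 1 :=
  open Classical in
  if hw : w = 0 then u else ⟨‖w‖⁻¹ • w, by simp [norm_smul, hw]⟩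

/-- One step `Φ̌_τ(x, u) = (Φ_τ(x), D_xΦ_τ u / |D_xΦ_τ u|)` of the projective chain. -/
def projectiveStep (f : Fin 3 → S1 → ℝ) (τ : Fin 3 → ℝ) (z : ST3) : ST3 :=
  (step f τ z.1, normalizeOr z.2 (torusFDeriv (step f τ) z.1 z.2))

/-- The law of `(τ₁, τ₂, τ₃)`: independent exponential random variables with mean `h`. -/
def timeLaw (h : ℝ) : Measure (Fin 3 → ℝ) := Measure.pi fun _ => expMeasure h⁻¹

/-- The transition kernel `P̌(z, A) = ℙ(Φ̌_τ(z) ∈ A)` of the projective chain. -/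
def projectiveKernel (f : Fin 3 → S1 → ℝ) (h : ℝ) : Kernel ST3 ST3 :=
  (Kernel.id ×ₖ Kernel.const ST3 (timeLaw h)).map fun p => projectiveStep f p.2 p.1

section Ergodicity

variable {M : Type*} [MeasurableSpace M]

/-- The action `Pg(x) = ∫ g(y) P(x, dy)` of a kernel on functions. -/
def markovOp (P : Kernel M M) (g : M → ℝ) (x : M) : ℝ := ∫ y, g y ∂(P x)

/-- The set of all `|g(x)| / V(x)`, whose supremum is `‖g‖_V`. -/
def weightedValues (V g : M → ℝ) : Set ℝ := range fun x => |g x| / V x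

/-- The weighted norm `‖g‖_V = sup_x |g(x)| / V(x)`, meant for `g ∈ 𝓜_V`. -/
def weightedNorm (V g : M → ℝ) : ℝ := sSup (weightedValues V g)

/-- The space `𝓜_V` of measurable functions with `‖g‖_V < ∞`. -/
def weightedSpace (V : M → ℝ) : Set (M → ℝ) :=
  {g | Measurable g ∧ BddAbove (weightedValues V g)}

/-- A stationary measure: a probability measure `μ` with `P^*μ = μ`. -/
def IsStationary (P : Kernel M M) (μ : Measure M) : Prop :=
  IsProbabilityMeasure μ ∧ P.Invariant μ

/-- `V`-uniform geometric ergodicity of `P`, for a function `V : M → [1, ∞)`. -/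
def IsVUniformlyGeometricallyErgodic (P : Kernel M M) (V : M → ℝ) : Prop :=
  ∃ μ : Measure M, IsStationary P μ ∧ (∀ ν : Measure M, IsStationary P ν → ν = μ) ∧
    ∃ C : ℝ, 0 < C ∧ ∃ γ ∈ Ioo (0 : ℝ) 1, ∀ m : ℕ, ∀ x : M, ∀ g ∈ weightedSpace V,
      |(markovOp P)^[m] g x - ∫ y, g y ∂μ| ≤ C * V x * weightedNorm V g * γ ^ m

/-- Uniform geometric ergodicity: the case `V ≡ 1`. -/
def IsUniformlyGeometricallyErgodic (P : Kernel M M) : Prop :=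
  IsVUniformlyGeometricallyErgodic P fun _ => 1

end Ergodicity

end

end RandomSplitting

/-! By Doeblin's criterion (`isUniformlyGeometricallyErgodic_of_le`) it suffices that some power of
the kernel dominates, from every starting point, one fixed nonzero measure ν. The sphere bundle is
compact, so a bound near each point with its own exponent and constant is enough
(`exists_le_pow_of_isMinorized`). Such a bound propagates backwards along any step with nonnegative
times, because nearby times have positive probability and the step is continuous
(`IsMinorized.of_step`). What remains is one point near which a bound holds, and a path of flows
leading from every point to its neighbourhood.

Number fields and coordinates 0, 1, 2, with indices modulo 3. The special point is (c, e₀), where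
the coordinates of c are critical points of the three functions; there `H1` makes the functions and
their second derivatives nonzero. At c the flow of the i-th field only turns coordinate i. A whole
turn is a loop over c, and it shears tangent vectors: a multiple of u (i+2) is added to u (i+1).
Along four steps containing three such loops, the derivative in the twelve times is onto the
six-dimensional tangent space of the tangent bundle (`velocities_fourStepMap`). A quantitative
submersion lemma turns this into a minorization (`exists_isMinorized`).

For accessibility, repeated loops over c steer directions towards e₀. Times are nonnegative, so each
shear acts with one sign only; a maximum and a minimum of `f 0` have curvatures of opposite sign and
together supply both signs (`IsAcc.of_ne_zero`). Base points are brought to c one coordinate at a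
time, since a function and its derivative never vanish together (`isAccOver`). All computations take
place on the tangent bundle of the covering space, where the step is smooth and linear in the
direction (`projectiveStep_sphereProj`). -/

namespace RandomSplitting

/-! ### Doeblin's theorem for minorized Markov kernels. -/

section Doeblin

open scoped ENNReal NNReal

variable {M : Type*} [MeasurableSpace M]

/-- Measurable functions that are bounded in absolute value. -/
structure IsBddMeas (g : M → ℝ) : Prop where
  measurable : Measurable g
  bdd : ∃ K, ∀ x, |g x| ≤ K

theorem IsBddMeas.integrable {g : M → ℝ} (hg : IsBddMeas g) (μ : Measure M) [IsFiniteMeasure μ] :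
    Integrable g μ := by
  obtain ⟨K, hK⟩ := hg.bdd
  exact Integrable.of_bound hg.measurable.aestronglyMeasurable K (ae_of_all _ fun x => by simpa using hK x)

theorem abs_integral_le_of_abs_le {g : M → ℝ} {K : ℝ} (hK : ∀ x, |g x| ≤ K) (μ : Measure M)
    [IsProbabilityMeasure μ] : |∫ x, g x ∂μ| ≤ K := by
  have := norm_integral_le_of_norm_le_const (μ := μ) (f := g) (C := K) (ae_of_all _ fun x => by simpa using hK x)
  simpa using this

theorem abs_markovOp_le {P : Kernel M M} [IsMarkovKernel P] {g : M → ℝ} {K : ℝ}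
    (hK : ∀ x, |g x| ≤ K) (x : M) : |markovOp P g x| ≤ K :=
  abs_integral_le_of_abs_le hK _

theorem IsBddMeas.markovOp {P : Kernel M M} [IsMarkovKernel P] {g : M → ℝ} (hg : IsBddMeas g) :
    IsBddMeas (markovOp P g) := by
  obtain ⟨K, hK⟩ := hg.bdd
  refine ⟨?_, K, abs_markovOp_le hK⟩
  exact (hg.measurable.stronglyMeasurable.integral_kernel (κ := P)).measurable

theorem IsBddMeas.iterate_markovOp {P : Kernel M M} [IsMarkovKernel P] {g : M → ℝ}
    (hg : IsBddMeas g) (n : ℕ) : IsBddMeas ((RandomSplitting.markovOp P)^[n] g) := by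
  induction n with
  | zero => exact hg
  | succ n ih => rw [Function.iterate_succ_apply']; exact ih.markovOp

theorem abs_iterate_markovOp_le {P : Kernel M M} [IsMarkovKernel P] {g : M → ℝ} {K : ℝ}
    (hK : ∀ x, |g x| ≤ K) (n : ℕ) (x : M) : |(markovOp P)^[n] g x| ≤ K := by
  induction n generalizing x with
  | zero => exact hK x
  | succ n ih => rw [Function.iterate_succ_apply']; exact abs_markovOp_le ih x

instance isMarkovKernel_pow (P : Kernel M M) [IsMarkovKernel P] (n : ℕ) : IsMarkovKernel (P ^ n) := by
  induction n with
  | zero => rw [pow_zero]; exact inferInstanceAs (IsMarkovKernel Kernel.id)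
  | succ n ih => rw [pow_succ]; exact inferInstanceAs (IsMarkovKernel ((P ^ n) ∘ₖ P))

theorem markovOp_comp (P Q : Kernel M M) [IsMarkovKernel P] [IsMarkovKernel Q] {g : M → ℝ}
    (hg : IsBddMeas g) : markovOp (P ∘ₖ Q) g = markovOp Q (markovOp P g) := by
  funext x
  exact Kernel.integral_comp (hg.integrable _)

theorem markovOp_pow (P : Kernel M M) [IsMarkovKernel P] (n : ℕ) {g : M → ℝ}
    (hg : IsBddMeas g) : markovOp (P ^ n) g = (markovOp P)^[n] g := by
  induction n with
  | zero =>
    funext x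
    rw [pow_zero]
    change ∫ y, g y ∂(Kernel.id x) = g x
    rw [Kernel.id_apply, integral_dirac' _ _ hg.measurable.stronglyMeasurable]
  | succ n ih =>
    rw [Function.iterate_succ_apply', ← ih, pow_succ]
    exact markovOp_comp (P ^ n) P hg

/-- The common part ν of `Q x` and `Q y` does not see the difference. With a = inf g one has 0 ≤ g -
a ≤ d; comparing the integral of g - a under ν and `Q y`, and that of d - (g - a) under ν and `Q x`,
the integrals of g against ν cancel. -/
theorem markovOp_sub_le {Q : Kernel M M} [IsMarkovKernel Q] {ν : Measure M} [IsFiniteMeasure ν]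
    (hν : ∀ x, ν ≤ Q x) {g : M → ℝ} (hg : IsBddMeas g) {d : ℝ} (hd : ∀ x y, g x - g y ≤ d) (x y : M) :
    markovOp Q g x - markovOp Q g y ≤ (1 - ν.real univ) * d := by
  have : Nonempty M := ⟨x⟩
  obtain ⟨K, hK⟩ := hg.bdd
  have hbelow : BddBelow (range g) := ⟨-K, by rintro _ ⟨z, rfl⟩; exact (abs_le.1 (hK z)).1⟩
  set a := ⨅ z, g z with ha
  have h0 : ∀ z, 0 ≤ g z - a := fun z => sub_nonneg.2 (ciInf_le hbelow z)
  have h1 : ∀ z, g z - a ≤ d := fun z => by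
    have : g z - d ≤ a := le_ciInf fun w => by linarith [hd z w]
    linarith
  have hi : ∀ μ : Measure M, IsFiniteMeasure μ → Integrable g μ := fun μ _ => hg.integrable μ
  have e1 : ∫ z, (g z - a) ∂ν ≤ ∫ z, (g z - a) ∂(Q y) :=
    integral_mono_measure (hν y) (ae_of_all _ h0) ((hi _ inferInstance).sub (integrable_const a))
  have e2 : ∫ z, (d - (g z - a)) ∂ν ≤ ∫ z, (d - (g z - a)) ∂(Q x) :=
    integral_mono_measure (hν x) (ae_of_all _ fun z => sub_nonneg.2 (h1 z))
      ((integrable_const d).sub ((hi _ inferInstance).sub (integrable_const a)))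
  have hs : ∀ μ : Measure M, IsFiniteMeasure μ →
      ∫ z, (g z - a) ∂μ = (∫ z, g z ∂μ) - a * μ.real univ := fun μ _ => by
    rw [integral_sub (hi _ inferInstance) (integrable_const a)]; simp [mul_comm]
  have hs' : ∀ μ : Measure M, IsFiniteMeasure μ →
      ∫ z, (d - (g z - a)) ∂μ = d * μ.real univ - ((∫ z, g z ∂μ) - a * μ.real univ) := fun μ _ => by
    have hga : Integrable (fun z => g z - a) μ := (hi _ inferInstance).sub (integrable_const a)
    rw [integral_sub (integrable_const d) hga, hs μ inferInstance]; simp [mul_comm]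
  rw [hs _ inferInstance, hs _ inferInstance] at e1
  rw [hs' _ inferInstance, hs' _ inferInstance] at e2
  simp only [probReal_univ] at e1 e2
  unfold markovOp
  linarith

/-- The rate ρ may exceed 1 - ν(M), so that a maximum with 0 or 1/2 can be used where a nonnegative
or positive rate is needed. -/
theorem iterate_markovOp_sub_le {Q : Kernel M M} [IsMarkovKernel Q] {ν : Measure M}
    [IsFiniteMeasure ν] (hν : ∀ x, ν ≤ Q x) {ρ : ℝ} (hρ : 1 - ν.real univ ≤ ρ) (hρ0 : 0 ≤ ρ)
    {g : M → ℝ} (hg : IsBddMeas g) {d : ℝ} (hd : ∀ x y, g x - g y ≤ d) (k : ℕ) (x y : M) :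
    (markovOp Q)^[k] g x - (markovOp Q)^[k] g y ≤ ρ ^ k * d := by
  induction k generalizing x y with
  | zero => simpa using hd x y
  | succ k ih =>
    have hd0 : 0 ≤ d := by simpa using hd x x
    rw [Function.iterate_succ_apply', pow_succ']
    calc _ ≤ (1 - ν.real univ) * (ρ ^ k * d) := markovOp_sub_le hν (hg.iterate_markovOp k) ih x y
      _ ≤ ρ * (ρ ^ k * d) := by gcongr
      _ = _ := by ring

/-- A minorized kernel has a stationary measure, the sum of the series `∑ ν Rᵏ` with
`R = Q - ν`. -/
theorem exists_isStationary_of_le [Nonempty M] {Q : Kernel M M} [IsMarkovKernel Q] {ν : Measure M}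
    [IsFiniteMeasure ν] (hν : ∀ x, ν ≤ Q x) (hν0 : ν ≠ 0) : ∃ μ, IsStationary Q μ := by
  let R : Kernel M M :=
    { toFun := fun x => Q x - ν
      measurable' := by
        refine Measure.measurable_of_measurable_coe _ fun s hs => ?_
        simp_rw [fun x => Measure.sub_apply hs (hν x)]
        exact (Kernel.measurable_coe Q hs).sub_const _ }
  have hR : ∀ x, R x + ν = Q x := fun x => Measure.sub_add_cancel_of_le (hν x)
  have hRu : ∀ x, R x univ = 1 - ν univ := fun x => by
    change (Q x - ν) univ = _
    rw [Measure.sub_apply .univ (hν x)]; simp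
  have hν1 : ν univ ≤ 1 := by
    obtain ⟨x⟩ := ‹Nonempty M›
    simpa using hν x univ
  let μ : Measure M := Measure.sum fun k : ℕ => ν.bind (R ^ k : Kernel M M)
  -- R has constant mass 1 - ν(M), so the masses form a geometric series of sum 1.
  have hmass : ∀ k : ℕ, ν.bind (R ^ k : Kernel M M) univ = ν univ * (1 - ν univ) ^ k := by
    have : ∀ (k : ℕ) (x : M), (R ^ k) x univ = (1 - ν univ) ^ k := by
      intro k
      induction k with
      | zero => intro x; rw [pow_zero, pow_zero]; change Kernel.id x univ = 1; simp
      | succ k ih =>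
        intro x
        rw [Kernel.pow_succ_apply_eq_lintegral _ _ _ .univ]
        simp [hRu, ih, pow_succ']
    intro k
    rw [Measure.bind_apply .univ (Kernel.aemeasurable _)]
    simp [this, mul_comm]
  have hμ1 : μ univ = 1 := by
    rw [Measure.sum_apply _ .univ]
    simp_rw [hmass]
    rw [ENNReal.tsum_mul_left, ENNReal.tsum_geometric, ENNReal.sub_sub_cancel ENNReal.one_ne_top hν1]
    exact ENNReal.mul_inv_cancel (by simpa using hν0) (measure_ne_top _ _)
  refine ⟨μ, ⟨hμ1⟩, ?_⟩
  have hμR : μ.bind R = Measure.sum fun k : ℕ => ν.bind (R ^ (k + 1) : Kernel M M) := by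
    rw [Measure.bind_sum _ _ (Kernel.aemeasurable _)]
    congr 1
    funext k
    rw [pow_succ']
    exact Measure.comp_assoc
  change μ.bind Q = μ
  ext s hs
  -- As μ has mass 1, the splitting Q = R + ν contributes exactly ν, the term k = 0 missing from μR.
  have h1 : μ.bind Q s = μ.bind R s + ν s := by
    rw [Measure.bind_apply hs (Kernel.aemeasurable _), Measure.bind_apply hs (Kernel.aemeasurable _)]
    simp_rw [← hR, Measure.add_apply]
    rw [lintegral_add_right _ measurable_const, lintegral_const, hμ1, mul_one]
  rw [h1, hμR, Measure.sum_apply _ hs, Measure.sum_apply _ hs, add_comm,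
    tsum_eq_zero_add' (f := fun k : ℕ => (ν.bind (R ^ k : Kernel M M)) s) ENNReal.summable, pow_zero]
  congr 2
  exact Measure.id_comp.symm

theorem integral_markovOp_of_isStationary {Q : Kernel M M} [IsMarkovKernel Q] {μ : Measure M}
    (hμ : IsStationary Q μ) {g : M → ℝ} (hg : IsBddMeas g) :
    ∫ x, markovOp Q g x ∂μ = ∫ x, g x ∂μ := by
  have := hμ.1
  conv_rhs => rw [← hμ.2.def]
  have h := Kernel.integral_comp (η := Q) (κ := Kernel.const Unit μ) (a := ()) (hg.integrable _)
  rw [Kernel.comp_const, Kernel.const_apply, Kernel.const_apply] at h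
  exact h.symm

theorem integral_iterate_markovOp_of_isStationary {Q : Kernel M M} [IsMarkovKernel Q]
    {μ : Measure M} (hμ : IsStationary Q μ) {g : M → ℝ} (hg : IsBddMeas g) (k : ℕ) :
    ∫ x, (markovOp Q)^[k] g x ∂μ = ∫ x, g x ∂μ := by
  induction k with
  | zero => rfl
  | succ k ih =>
    rw [Function.iterate_succ_apply', integral_markovOp_of_isStationary hμ (hg.iterate_markovOp k), ih]

theorem abs_sub_integral_le {μ : Measure M} [IsProbabilityMeasure μ] {g : M → ℝ} (hg : IsBddMeas g)
    {d : ℝ} (hd : ∀ x y, g x - g y ≤ d) (x : M) : |g x - ∫ y, g y ∂μ| ≤ d := by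
  have : g x - ∫ y, g y ∂μ = ∫ y, (g x - g y) ∂μ := by
    rw [integral_sub (integrable_const _) (hg.integrable _)]; simp
  rw [this]
  exact abs_integral_le_of_abs_le (fun y => abs_le.2 ⟨by linarith [hd y x], hd x y⟩) _

/-- The k-th iterate of an indicator has oscillation at most ρ ^ k, and its integral against a
stationary measure is the measure of the set. Hence both measures of the set lie within ρ ^ k of the
same value. -/
theorem IsStationary.eq_of_le [Nonempty M] {Q : Kernel M M} [IsMarkovKernel Q] {ν : Measure M}
    [IsFiniteMeasure ν] (hν : ∀ x, ν ≤ Q x) (hν0 : ν ≠ 0) {μ₁ μ₂ : Measure M}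
    (h₁ : IsStationary Q μ₁) (h₂ : IsStationary Q μ₂) : μ₁ = μ₂ := by
  have := h₁.1
  have := h₂.1
  obtain ⟨x⟩ := ‹Nonempty M›
  have hε : 0 < ν.real univ := by
    rw [measureReal_def, ENNReal.toReal_pos_iff]
    exact ⟨pos_iff_ne_zero.2 (by simpa using hν0), measure_lt_top _ _⟩
  set ρ := max (1 - ν.real univ) 0
  have hρ1 : ρ < 1 := max_lt (by linarith) one_pos
  have hρ0 : 0 ≤ ρ := le_max_right _ _
  ext s hs
  have hg : IsBddMeas (s.indicator (fun _ => (1 : ℝ))) :=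
    ⟨measurable_const.indicator hs, 1, fun x => by by_cases h : x ∈ s <;> simp [h]⟩
  have hd : ∀ x y, s.indicator (fun _ => (1 : ℝ)) x - s.indicator (fun _ => (1 : ℝ)) y ≤ 1 := by
    intro x y
    by_cases h : x ∈ s <;> by_cases h' : y ∈ s <;> simp [h, h']
  have key : ∀ k : ℕ, |μ₁.real s - μ₂.real s| ≤ 2 * ρ ^ k := by
    intro k
    have b := fun (μ : Measure M) (hμ : IsStationary Q μ) => by
      have := hμ.1
      have := abs_sub_integral_le (μ := μ) (hg.iterate_markovOp (P := Q) k)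
        (iterate_markovOp_sub_le hν (le_max_left _ _) hρ0 hg hd k) x
      rwa [integral_iterate_markovOp_of_isStationary hμ hg, integral_indicator_const _ hs,
        smul_eq_mul, mul_one, mul_one] at this
    have b1 := abs_le.1 (b μ₁ h₁)
    have b2 := abs_le.1 (b μ₂ h₂)
    rw [abs_le]
    constructor <;> linarith [b1.1, b1.2, b2.1, b2.2]
  have lim : Filter.Tendsto (fun k : ℕ => 2 * ρ ^ k) Filter.atTop (nhds 0) := by
    simpa using (tendsto_pow_atTop_nhds_zero_of_lt_one hρ0 hρ1).const_mul 2
  have h0 : |μ₁.real s - μ₂.real s| ≤ 0 := ge_of_tendsto' lim key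
  have := sub_eq_zero.1 (abs_nonpos_iff.1 h0)
  rwa [measureReal_def, measureReal_def, ENNReal.toReal_eq_toReal_iff' (measure_ne_top _ _)
    (measure_ne_top _ _)] at this

theorem IsStationary.pow {P : Kernel M M} [IsMarkovKernel P] {μ : Measure M}
    (hμ : IsStationary P μ) (n : ℕ) : IsStationary (P ^ n) μ := by
  refine ⟨hμ.1, ?_⟩
  induction n with
  | zero => rw [pow_zero]; exact Measure.id_comp
  | succ n ih => rw [pow_succ]; exact Kernel.Invariant.comp ih hμ.2

/-- Doeblin's theorem. -/
theorem isUniformlyGeometricallyErgodic_of_le [Nonempty M] (P : Kernel M M) [IsMarkovKernel P]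
    {n : ℕ} {ν : Measure M} [IsFiniteMeasure ν] (hν : ∀ x, ν ≤ (P ^ n) x) (hν0 : ν ≠ 0) :
    IsUniformlyGeometricallyErgodic P := by
  obtain ⟨μ, hμ⟩ := exists_isStationary_of_le hν hν0
  have := hμ.1
  have hμP : IsStationary P μ := by
    refine ⟨hμ.1, ?_⟩
    -- P commutes with its power, so μP is also stationary for P ^ n and must equal μ.
    refine IsStationary.eq_of_le hν hν0 ⟨inferInstanceAs (IsProbabilityMeasure (P ∘ₘ μ)), ?_⟩ hμ
    change (P ^ n) ∘ₘ (P ∘ₘ μ) = P ∘ₘ μ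
    rw [Measure.comp_assoc]
    conv_rhs => rw [← hμ.2.def, Measure.comp_assoc]
    change (P ^ n * P) ∘ₘ μ = (P * P ^ n) ∘ₘ μ
    rw [← pow_succ, ← pow_succ']
  have hε : 0 < ν.real univ := by
    rw [measureReal_def, ENNReal.toReal_pos_iff]
    exact ⟨pos_iff_ne_zero.2 (by simpa using hν0), measure_lt_top _ _⟩
  set ρ := max (1 - ν.real univ) (1 / 2) with hρ
  have hρ1 : ρ < 1 := max_lt (by linarith) (by norm_num)
  have hρ0 : 0 < ρ := lt_of_lt_of_le (by norm_num) (le_max_right _ _)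
  -- The root of order n + 1, rather than n, also covers n = 0.
  set γ := ρ ^ ((n + 1 : ℝ)⁻¹) with hγ
  have hn : (0 : ℝ) < (n + 1 : ℝ)⁻¹ := by positivity
  have hγ0 : 0 < γ := Real.rpow_pos_of_pos hρ0 _
  have hγ1 : γ < 1 := Real.rpow_lt_one hρ0.le hρ1 hn
  have hγn : γ ^ (n + 1) = ρ := by
    rw [hγ, ← Real.rpow_natCast, ← Real.rpow_mul hρ0.le]
    push_cast
    rw [inv_mul_cancel₀ (by positivity), Real.rpow_one]
  refine ⟨μ, hμP, fun μ' h' => IsStationary.eq_of_le hν hν0 (h'.pow n) hμ, 2 / ρ, by positivity, γ,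
    ⟨hγ0, hγ1⟩, ?_⟩
  rintro m x g ⟨hgm, hgb⟩
  set K := weightedNorm (fun _ => 1) g with hK
  have hgK : ∀ y, |g y| ≤ K := fun y => by
    have : |g y| / 1 ≤ K := le_csSup hgb ⟨y, rfl⟩
    rwa [div_one] at this
  have hg : IsBddMeas g := ⟨hgm, K, hgK⟩
  have hK0 : 0 ≤ K := (abs_nonneg _).trans (hgK x)
  -- Take m / (n + 1) blocks of length n; the leftover steps are applied to g first and keep it
  -- bounded by K.
  have hdecomp : (markovOp P)^[m] g = (markovOp (P ^ n))^[m / (n + 1)] ((markovOp P)^[m - n * (m / (n + 1))] g) := by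
    have : ∀ (k : ℕ) (g' : M → ℝ), IsBddMeas g' → (markovOp (P ^ n))^[k] g' = (markovOp P)^[n * k] g' := by
      intro k g' hg'
      induction k with
      | zero => rfl
      | succ k ih =>
        rw [Function.iterate_succ_apply', ih, markovOp_pow _ _ (hg'.iterate_markovOp _),
          ← Function.iterate_add_apply, Nat.mul_succ, add_comm]
    rw [this _ _ (hg.iterate_markovOp _), ← Function.iterate_add_apply]
    congr 2
    have : n * (m / (n + 1)) ≤ m :=
      (Nat.mul_le_mul_right _ (Nat.le_succ n)).trans (Nat.mul_div_le m (n + 1))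
    omega
  have hosc : ∀ y z, (markovOp P)^[m] g y - (markovOp P)^[m] g z ≤ ρ ^ (m / (n + 1)) * (2 * K) := by
    rw [hdecomp]
    refine iterate_markovOp_sub_le hν (le_max_left _ _) hρ0.le (hg.iterate_markovOp _) ?_ _
    intro y z
    have h1 := abs_le.1 (abs_iterate_markovOp_le (P := P) hgK (m - n * (m / (n + 1))) y)
    have h2 := abs_le.1 (abs_iterate_markovOp_le (P := P) hgK (m - n * (m / (n + 1))) z)
    linarith [h1.1, h1.2, h2.1, h2.2]
  have hmain := abs_sub_integral_le (μ := μ) (hg.iterate_markovOp (P := P) m) hosc x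
  rw [integral_iterate_markovOp_of_isStationary hμP hg] at hmain
  refine hmain.trans ?_
  -- Since m < (n + 1)(m / (n + 1) + 1), rounding down costs one factor ρ, whence the constant 2 /
  -- ρ.
  have hpow : ρ ^ (m / (n + 1)) * ρ ≤ γ ^ m := by
    rw [← pow_succ, ← hγn, ← pow_mul]
    exact pow_le_pow_of_le_one hγ0.le hγ1.le (Nat.lt_mul_div_succ m (Nat.succ_pos n)).le
  have : ρ ^ (m / (n + 1)) ≤ γ ^ m / ρ := by rwa [le_div_iff₀ hρ0]
  calc _ ≤ γ ^ m / ρ * (2 * K) := by gcongr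
    _ = _ := by ring

end Doeblin

end RandomSplitting

namespace RandomSplitting

/-! ### A quantitative submersion lemma up to the boundary of the parameter set. -/

section Submersion

open scoped ENNReal NNReal Topology
open Metric

/-- The pushforward of Lebesgue measure on an open set under a map whose partial derivative at a
point of the closure is onto dominates Lebesgue measure on some ball, uniformly in the parameter. -/
theorem exists_le_measure_inter_preimage {E Θ F : Type*} [NormedAddCommGroup E] [NormedSpace ℝ E]
    [NormedAddCommGroup Θ] [NormedSpace ℝ Θ] [FiniteDimensional ℝ Θ] [MeasurableSpace Θ] [BorelSpace Θ]
    [NormedAddCommGroup F] [NormedSpace ℝ F] [FiniteDimensional ℝ F] [MeasurableSpace F] [BorelSpace F]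
    (l : Measure Θ) [l.IsAddHaarMeasure] (μ : Measure F) [μ.IsAddHaarMeasure]
    {g : E × Θ → F} (hg : Continuous g) {g' : E × Θ →L[ℝ] F} {p : E} {θ : Θ}
    (hd : HasStrictFDerivAt g g' (p, θ)) (hs : ∀ w, ∃ t, g' (0, t) = w)
    {O : Set Θ} (hO : IsOpen O) (hθ : θ ∈ closure O) :
    ∃ N ∈ 𝓝 p, ∃ δ : ℝ≥0∞, 0 < δ ∧ δ ≠ ∞ ∧ ∃ (w : F) (r : ℝ), 0 < r ∧
      ∀ q ∈ N, ∀ A ⊆ ball w r, MeasurableSet A → δ * μ A ≤ l (O ∩ {t | g (q, t) ∈ A}) := by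
  have : CompleteSpace F := FiniteDimensional.complete ℝ F
  have : ProperSpace Θ := FiniteDimensional.proper ℝ Θ
  have : ProperSpace F := FiniteDimensional.proper ℝ F
  obtain ⟨σ, hσ⟩ : ∃ σ : F →L[ℝ] Θ, ∀ w, g' (0, σ w) = w := by
    obtain ⟨σ, hσ⟩ := LinearMap.exists_rightInverse_of_surjective
      ((g'.comp (ContinuousLinearMap.inr ℝ E Θ) : Θ →L[ℝ] F) : Θ →ₗ[ℝ] F)
      (LinearMap.range_eq_top.2 fun w => by obtain ⟨t, ht⟩ := hs w; exact ⟨t, by simpa using ht⟩)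
    refine ⟨LinearMap.toContinuousLinearMap σ, fun w => ?_⟩
    simpa using LinearMap.congr_fun hσ w
  -- A map this close to the identity at most doubles volumes, as 2 > det id; c' < 1/2 will make its
  -- image of a ball of radius η contain one of radius η / 2.
  obtain ⟨c', hc', hc0, hc2⟩ : ∃ c' : ℝ≥0, (∀ (s : Set F) (f : F → F),
      ApproximatesLinearOn f (ContinuousLinearMap.id ℝ F) s c' → μ (f '' s) ≤ (2 : ℝ≥0) * μ s) ∧
      0 < c' ∧ c' < 1 / 2 := by
    have h1 := addHaar_image_le_mul_of_det_lt μ (ContinuousLinearMap.id ℝ F) (m := 2)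
      (by
        have : (ContinuousLinearMap.id ℝ F).det = 1 := LinearMap.det_id
        rw [this]; norm_num)
    have h2 : ∀ᶠ c in 𝓝[>] (0 : ℝ≥0), 0 < c ∧ c < 1 / 2 :=
      Ioo_mem_nhdsGT (by norm_num : (0 : ℝ≥0) < 1 / 2)
    obtain ⟨c, h3, h4⟩ := (h1.and h2).exists
    exact ⟨c, h3, h4⟩
  set s : ℝ≥0 := ‖σ‖₊ + 1 with hs_def
  have hs0 : 0 < s := by positivity
  -- Dividing by s ≥ ‖σ‖ leaves the error c' after composition with σ.
  obtain ⟨U, hU, hUa⟩ := hd.approximates_deriv_on_nhds (c := c' / s) (Or.inr (by positivity))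
  obtain ⟨r, hr, hrU⟩ := Metric.mem_nhds_iff.1 hU
  -- θ may lie on the boundary of O: move to a nearby point of O where the linear approximation
  -- still holds.
  obtain ⟨k₀, hk₀b, hk₀O⟩ := mem_closure_iff.1 hθ (ball θ r) isOpen_ball (mem_ball_self hr)
  obtain ⟨ε, hε, hεO⟩ := Metric.isOpen_iff.1 (hO.inter isOpen_ball) k₀ ⟨hk₀O, hk₀b⟩
  set η : ℝ := ε / (2 * s) with hη_def
  have hη : 0 < η := by positivity
  obtain ⟨r₁, hr₁, hr₁g⟩ := Metric.mem_nhds_iff.1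
    (hg.continuousAt.preimage_mem_nhds (ball_mem_nhds (g (p, k₀)) (show 0 < η / 4 by positivity)))
  set K := ball k₀ (min (ε / 2) r₁) with hK
  set B := closedBall (0 : F) η with hB
  have hσB : ∀ k ∈ K, ∀ y ∈ B, k + σ y ∈ ball k₀ ε := by
    intro k hk y hy
    have h1 : ‖σ y‖ ≤ ε / 2 := by
      calc ‖σ y‖ ≤ ‖σ‖ * ‖y‖ := σ.le_opNorm y
        _ ≤ s * η := by
          have : ‖y‖ ≤ η := by simpa [hB] using hy
          have : ‖σ‖ ≤ s := by simp [hs_def]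
          gcongr
        _ = ε / 2 := by rw [hη_def]; field_simp
    have h2 : dist k k₀ < ε / 2 := lt_of_lt_of_le (mem_ball.1 hk) (min_le_left _ _)
    rw [mem_ball, dist_eq_norm] at *
    calc ‖k + σ y - k₀‖ = ‖(k - k₀) + σ y‖ := by congr 1; abel
      _ ≤ ‖k - k₀‖ + ‖σ y‖ := norm_add_le _ _
      _ < ε := by linarith
  have happ : ∀ q ∈ ball p (min r r₁), ∀ k ∈ K,
      ApproximatesLinearOn (fun y => g (q, k + σ y)) (ContinuousLinearMap.id ℝ F) B c' := by
    intro q hq k hk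
    have hmem : ∀ y ∈ B, (q, k + σ y) ∈ U := fun y hy => hrU <| by
      rw [← ball_prod_same]
      exact ⟨ball_subset_ball (min_le_left _ _) hq, (hεO (hσB k hk y hy)).2⟩
    intro y hy y' hy'
    have h3 := hUa _ (hmem y hy) _ (hmem y' hy')
    have h4 : ‖((q, k + σ y) : E × Θ) - (q, k + σ y')‖ ≤ s * ‖y - y'‖ := by
      have : ((q, k + σ y) : E × Θ) - (q, k + σ y') = (0, σ (y - y')) := by
        ext <;> simp
      rw [this, Prod.norm_mk, norm_zero, max_eq_right (norm_nonneg _)]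
      have h' : ‖σ‖ ≤ s := by simp [hs_def]
      exact (σ.le_opNorm _).trans (by gcongr)
    have h5 : g' (((q, k + σ y) : E × Θ) - (q, k + σ y')) = y - y' := by
      have : ((q, k + σ y) : E × Θ) - (q, k + σ y') = (0, σ (y - y')) := by
        ext <;> simp
      rw [this, hσ]
    rw [h5] at h3
    refine h3.trans ?_
    calc ((c' / s : ℝ≥0) : ℝ) * _ ≤ ((c' / s : ℝ≥0) : ℝ) * (s * ‖y - y'‖) := by gcongr
      _ = c' * ‖y - y'‖ := by push_cast; field_simp
  -- On each affine slice k + σ(B) the map is nearly the identity, so it covers A and cannot enlarge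
  -- volumes by more than 2.
  have hA : ∀ q ∈ ball p (min r r₁), ∀ k ∈ K, ∀ A ⊆ ball (g (p, k₀)) (η / 4),
      μ A ≤ 2 * μ (B ∩ {y | g (q, k + σ y) ∈ A}) := by
    intro q hq k hk A hA
    have hsurj := (happ q hq k hk).surjOn_closedBall_of_nonlinearRightInverse
      ⟨id, 1, fun y => by simp, fun y => rfl⟩ hη.le (b := 0) Subset.rfl
    have hAs : A ⊆ (fun y => g (q, k + σ y)) '' (B ∩ {y | g (q, k + σ y) ∈ A}) := by
      intro a ha
      have h1 : dist a (g (p, k₀)) < η / 4 := hA ha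
      have h2 : dist (g (q, k)) (g (p, k₀)) < η / 4 := hr₁g <| by
        rw [← ball_prod_same]
        exact ⟨ball_subset_ball (min_le_right _ _) hq, ball_subset_ball (min_le_right _ _) hk⟩
      have h3 : a ∈ closedBall (g (q, k + σ 0)) ((((1 : ℝ≥0) : ℝ)⁻¹ - c') * η) := by
        rw [map_zero, add_zero, mem_closedBall]
        have h4 : dist a (g (q, k)) ≤ η / 2 := by
          have := dist_triangle_right a (g (q, k)) (g (p, k₀))
          linarith
        have h5 : (c' : ℝ) ≤ 1 / 2 := by exact_mod_cast hc2.le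
        refine h4.trans ?_
        simp only [NNReal.coe_one, inv_one]
        nlinarith
      obtain ⟨y, hy, rfl⟩ := hsurj h3
      exact ⟨y, ⟨hy, ha⟩, rfl⟩
    refine (measure_mono hAs).trans ?_
    have := hc' _ _ ((happ q hq k hk).mono_set (inter_subset_left (t := {y | g (q, k + σ y) ∈ A})))
    simpa using this
  have hKpos : 0 < l K := measure_ball_pos _ _ (by positivity)
  have hKfin : l K ≠ ∞ := measure_ball_lt_top.ne
  have hBpos : 0 < μ B := measure_closedBall_pos _ _ hη
  have hBfin : μ B ≠ ∞ := measure_closedBall_lt_top.ne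
  refine ⟨ball p (min r r₁), ball_mem_nhds _ (by positivity), l K / (2 * μ B), ?_, ?_,
    g (p, k₀), η / 4, by positivity, ?_⟩
  · exact ENNReal.div_pos hKpos.ne' (ENNReal.mul_ne_top ENNReal.ofNat_ne_top hBfin)
  · exact ENNReal.div_ne_top hKfin (mul_ne_zero two_ne_zero hBpos.ne')
  intro q hq A hAW hAm
  -- Fubini on T: slices at fixed k bound its measure below by the slice estimate, slices at fixed y
  -- bound it above by translation invariance of `l`.
  set T : Set (Θ × F) := {x | x.1 ∈ K ∧ x.2 ∈ B ∧ g (q, x.1 + σ x.2) ∈ A} with hT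
  have hTm : MeasurableSet T := by
    refine (measurable_fst isOpen_ball.measurableSet).inter
      ((measurable_snd isClosed_closedBall.measurableSet).inter ?_)
    have : Continuous fun x : Θ × F => g (q, x.1 + σ x.2) := by fun_prop
    exact this.measurable hAm
  have h1 : l K * μ A ≤ 2 * (l.prod μ) T := by
    rw [Measure.prod_apply hTm, ← lintegral_const_mul' _ _ ENNReal.ofNat_ne_top, mul_comm,
      ← setLIntegral_const]
    rw [← lintegral_indicator isOpen_ball.measurableSet]
    refine lintegral_mono fun k => ?_
    by_cases hk : k ∈ K
    · rw [indicator_of_mem hk]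
      refine (hA q hq k hk A hAW).trans ?_
      gcongr
      intro y hy
      exact ⟨hk, hy.1, hy.2⟩
    · rw [indicator_of_notMem hk]; exact zero_le
  have h2 : (l.prod μ) T ≤ l (O ∩ {t | g (q, t) ∈ A}) * μ B := by
    rw [Measure.prod_apply_symm hTm, ← setLIntegral_const,
      ← lintegral_indicator isClosed_closedBall.measurableSet]
    refine lintegral_mono fun y => ?_
    by_cases hy : y ∈ B
    · rw [indicator_of_mem hy]
      refine le_trans (measure_mono fun k hk => ?_) (measure_preimage_add_right l (σ y) _).le
      have hk' : k ∈ K ∧ y ∈ B ∧ g (q, k + σ y) ∈ A := hk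
      exact ⟨(hεO (hσB k hk'.1 y hy)).1, hk'.2.2⟩
    · rw [indicator_of_notMem hy]
      refine le_of_eq ?_
      convert measure_empty (μ := l)
      ext k
      simp [hT, hy]
  rw [ENNReal.div_eq_inv_mul, mul_assoc]
  rw [ENNReal.inv_mul_le_iff (mul_ne_zero two_ne_zero hBpos.ne')
    (ENNReal.mul_ne_top ENNReal.ofNat_ne_top hBfin)]
  calc _ ≤ 2 * (l.prod μ) T := h1
    _ ≤ 2 * (l (O ∩ {t | g (q, t) ∈ A}) * μ B) := by gcongr
    _ = _ := by ring

end Submersion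

end RandomSplitting

/-! ### The chain lifted to the tangent bundle of the covering space. -/

namespace RandomSplitting

noncomputable section

open scoped ENNReal NNReal Topology ContDiff
open Filter

variable (f : Fin 3 → S1 → ℝ)

/-! ### The covering map -/

theorem proj_add (v w : E3) : proj (v + w) = proj v + proj w := by
  funext i; simp [proj]

theorem isOpenQuotientMap_proj : IsOpenQuotientMap proj := by
  have h : IsOpenQuotientMap (Pi.map fun _ : Fin 3 => ((↑) : ℝ → S1)) :=
    IsOpenQuotientMap.piMap fun _ => QuotientAddGroup.isOpenQuotientMap_mk
  exact h.comp (EuclideanSpace.equiv (Fin 3) ℝ).toHomeomorph.isOpenQuotientMap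

theorem torusLog_proj {w : E3} (hw : ∀ i, w i ∈ Ioc (-π) (-π + 2 * π)) : torusLog (proj w) = w := by
  ext i
  simp only [torusLog, proj]
  rw [AddCircle.equivIoc_coe_eq (hw i)]

theorem eventually_torusLog_proj : ∀ᶠ w in 𝓝 (0 : E3), torusLog (proj w) = w := by
  have : ∀ᶠ w : E3 in 𝓝 0, ∀ i, w i ∈ Ioc (-π) (-π + 2 * π) := by
    rw [eventually_all]
    intro i
    have hc : ContinuousAt (fun w : E3 => w i) 0 := by fun_prop
    refine hc.preimage_mem_nhds (mem_of_superset (Ioo_mem_nhds ?_ ?_) Ioo_subset_Ioc_self) <;>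
      simp <;> linarith [Real.pi_pos]
  exact this.mono fun w => torusLog_proj

/-! ### Lifts of the functions, fields and flows -/

/-- The periodic function on the line induced by `f i`. -/
def lift (i : Fin 3) (s : ℝ) : ℝ := f i (s : S1)

theorem circleDeriv_coe (g : S1 → ℝ) (s : ℝ) :
    circleDeriv g (s : S1) = deriv (fun r : ℝ => g (r : S1)) s := by
  have := deriv_comp_const_add (fun r : ℝ => g (r : S1)) s 0
  simpa [circleDeriv, add_zero] using this

theorem circleDeriv_lift (i : Fin 3) (s : ℝ) : circleDeriv (f i) (s : S1) = deriv (lift f i) s :=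
  circleDeriv_coe (f i) s

theorem circleDeriv_circleDeriv_lift (i : Fin 3) (s : ℝ) :
    circleDeriv (circleDeriv (f i)) (s : S1) = deriv (deriv (lift f i)) s := by
  rw [circleDeriv_coe]
  congr 1
  funext r
  exact circleDeriv_lift f i r

/-- The standard basis vectors. -/
abbrev basisVec (i : Fin 3) : E3 := EuclideanSpace.single i 1

/-- The vector field `Xᵢ` on the covering space. -/
def liftField (i : Fin 3) (y : E3) : E3 :=
  lift f i (y (i + 2)) • basisVec i + deriv (lift f i) (y (i + 2)) • basisVec (i + 1)

/-- The differential of `liftField`. -/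
def liftFieldDeriv (i : Fin 3) (y : E3) : E3 →L[ℝ] E3 :=
  (EuclideanSpace.proj (i + 2) : E3 →L[ℝ] ℝ).smulRight
    (deriv (lift f i) (y (i + 2)) • basisVec i + deriv (deriv (lift f i)) (y (i + 2)) • basisVec (i + 1))

theorem liftFieldDeriv_apply (i : Fin 3) (y v : E3) : liftFieldDeriv f i y v =
    v (i + 2) • (deriv (lift f i) (y (i + 2)) • basisVec i +
      deriv (deriv (lift f i)) (y (i + 2)) • basisVec (i + 1)) := by
  simp [liftFieldDeriv]

/-- The flow of `Xᵢ` on the covering space. -/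
def baseFlow (i : Fin 3) (t : ℝ) (y : E3) : E3 := y + t • liftField f i y

/-- The differential of the flow of `Xᵢ` as a map of the tangent bundle of the covering space. -/
def tangentFlow (i : Fin 3) (t : ℝ) (q : E3 × E3) : E3 × E3 :=
  (baseFlow f i t q.1, q.2 + t • liftFieldDeriv f i q.1 q.2)

/-- One step of the chain on the tangent bundle of the covering space. -/
def tangentStep (τ : Fin 3 → ℝ) (q : E3 × E3) : E3 × E3 :=
  tangentFlow f 2 (τ 2) (tangentFlow f 1 (τ 1) (tangentFlow f 0 (τ 0) q))

theorem vectorField_proj (i : Fin 3) (y : E3) : vectorField f i (proj y) = liftField f i y := by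
  fin_cases i <;> ext j <;> fin_cases j <;>
    simp [vectorField, liftField, proj, circleDeriv_lift, lift]

theorem proj_baseFlow (i : Fin 3) (t : ℝ) (y : E3) :
    proj (baseFlow f i t y) = flow f i t (proj y) := by
  rw [baseFlow, flow, proj_add, vectorField_proj]

theorem proj_tangentStep (τ : Fin 3 → ℝ) (q : E3 × E3) :
    proj (tangentStep f τ q).1 = step f τ (proj q.1) := by
  simp only [tangentStep, tangentFlow, proj_baseFlow, step]

variable {f}

theorem contDiff_lift (hf : ∀ i, IsAnalyticOnCircle (f i)) (i : Fin 3) : ContDiff ℝ ∞ (lift f i) :=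
  (hf i).contDiff

theorem contDiff_deriv_lift (hf : ∀ i, IsAnalyticOnCircle (f i)) (i : Fin 3) :
    ContDiff ℝ ∞ (deriv (lift f i)) :=
  (contDiff_infty_iff_deriv.1 (contDiff_lift hf i)).2

theorem contDiff_deriv_deriv_lift (hf : ∀ i, IsAnalyticOnCircle (f i)) (i : Fin 3) :
    ContDiff ℝ ∞ (deriv (deriv (lift f i))) :=
  (contDiff_infty_iff_deriv.1 (contDiff_deriv_lift hf i)).2

theorem hasFDerivAt_liftField (hf : ∀ i, IsAnalyticOnCircle (f i)) (i : Fin 3) (y : E3) :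
    HasFDerivAt (liftField f i) (liftFieldDeriv f i y) y := by
  have hp : HasFDerivAt (fun y : E3 => y (i + 2)) (EuclideanSpace.proj (i + 2) : E3 →L[ℝ] ℝ) y :=
    (EuclideanSpace.proj (i + 2) : E3 →L[ℝ] ℝ).hasFDerivAt
  have h1 : HasDerivAt (lift f i) (deriv (lift f i) (y (i + 2))) (y (i + 2)) :=
    ((contDiff_lift hf i).differentiable (by simp)).differentiableAt.hasDerivAt
  have h2 : HasDerivAt (deriv (lift f i)) (deriv (deriv (lift f i)) (y (i + 2))) (y (i + 2)) :=
    ((contDiff_deriv_lift hf i).differentiable (by simp)).differentiableAt.hasDerivAt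
  have : HasFDerivAt (liftField f i) _ y := ((h1.comp_hasFDerivAt y hp).smul_const (basisVec i)).add
    ((h2.comp_hasFDerivAt y hp).smul_const (basisVec (i + 1)))
  refine this.congr_fderiv ?_
  ext1 v
  simp [liftFieldDeriv, smul_smul, mul_comm]

theorem hasFDerivAt_baseFlow (hf : ∀ i, IsAnalyticOnCircle (f i)) (i : Fin 3) (t : ℝ) (y : E3) :
    HasFDerivAt (baseFlow f i t) (ContinuousLinearMap.id ℝ E3 + t • liftFieldDeriv f i y) y :=
  (hasFDerivAt_id y).add ((hasFDerivAt_liftField hf i y).const_smul t)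

theorem contDiff_tangentFlow (hf : ∀ i, IsAnalyticOnCircle (f i)) (i : Fin 3) :
    ContDiff ℝ ∞ fun x : ℝ × (E3 × E3) => tangentFlow f i x.1 x.2 := by
  have h0 := contDiff_lift hf i
  have h1 := contDiff_deriv_lift hf i
  have h2 := contDiff_deriv_deriv_lift hf i
  simp only [tangentFlow, baseFlow, liftField, liftFieldDeriv_apply]
  have hc : ContDiff ℝ ∞ fun x : ℝ × (E3 × E3) => x.2.1 (i + 2) := by fun_prop
  have hc' : ContDiff ℝ ∞ fun x : ℝ × (E3 × E3) => x.2.2 (i + 2) := by fun_prop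
  have k0 := h0.comp hc
  have k1 := h1.comp hc
  have k2 := h2.comp hc
  simp only [Function.comp_def] at k0 k1 k2
  fun_prop

theorem contDiff_tangentStep (hf : ∀ i, IsAnalyticOnCircle (f i)) :
    ContDiff ℝ ∞ fun x : (Fin 3 → ℝ) × (E3 × E3) => tangentStep f x.1 x.2 := by
  have h0 := contDiff_tangentFlow hf 0
  have h1 := contDiff_tangentFlow hf 1
  have h2 := contDiff_tangentFlow hf 2
  have c0 := h0.comp (f := fun x : (Fin 3 → ℝ) × (E3 × E3) => (x.1 0, x.2)) (by fun_prop)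
  have c1 := h1.comp (f := fun x : (Fin 3 → ℝ) × (E3 × E3) => (x.1 1, tangentFlow f 0 (x.1 0) x.2))
    (ContDiff.prodMk (by fun_prop) c0)
  exact h2.comp (f := fun x : (Fin 3 → ℝ) × (E3 × E3) =>
    (x.1 2, tangentFlow f 1 (x.1 1) (tangentFlow f 0 (x.1 0) x.2)))
    (ContDiff.prodMk (by fun_prop) c1)

/-- Near v = 0 the displacement of the lifted map is small, so `torusLog` undoes `proj`; the chart
expression then agrees with that displacement and the chain rule applies. -/
theorem torusFDeriv_step (hf : ∀ i, IsAnalyticOnCircle (f i)) (τ : Fin 3 → ℝ) (y u : E3) :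
    torusFDeriv (step f τ) (proj y) u = (tangentStep f τ (y, u)).2 := by
  set A : E3 → E3 := fun w => baseFlow f 2 (τ 2) (baseFlow f 1 (τ 1) (baseFlow f 0 (τ 0) w)) with hA
  have hAp : ∀ w, proj (A w) = step f τ (proj w) := fun w => by
    simp only [hA, proj_baseFlow, step]
  have hAd := (hasFDerivAt_baseFlow hf 2 (τ 2) _).comp y
    ((hasFDerivAt_baseFlow hf 1 (τ 1) _).comp y (hasFDerivAt_baseFlow hf 0 (τ 0) y))
  have hs : HasFDerivAt (fun v : E3 => y + v) (ContinuousLinearMap.id ℝ E3) 0 :=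
    (hasFDerivAt_id (0 : E3)).const_add y
  rw [← add_zero y] at hAd
  have hB := (hAd.comp (0 : E3) hs).sub_const (A y)
  simp only [add_zero] at hB
  have hev : (fun v : E3 => torusLog (step f τ (proj y + proj v) - step f τ (proj y))) =ᶠ[𝓝 0]
      fun v => A (y + v) - A y := by
    have ht : Tendsto (fun v : E3 => A (y + v) - A y) (𝓝 0) (𝓝 0) := by
      have := hB.continuousAt.tendsto
      simpa [hA, Function.comp_def] using this
    refine (ht.eventually eventually_torusLog_proj).mono fun v hv => ?_
    simp only at hv ⊢
    conv_rhs => rw [← hv]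
    congr 1
    rw [← proj_add, ← hAp, ← hAp, sub_eq_iff_eq_add, ← proj_add, sub_add_cancel]
  rw [torusFDeriv, hev.fderiv_eq]
  have hB' : HasFDerivAt (fun v : E3 => A (y + v) - A y) _ 0 := hB
  rw [hB'.fderiv]
  simp [tangentStep, tangentFlow]
  module

/-! ### Homogeneity and injectivity of the tangent flows -/

theorem tangentFlow_smul (i : Fin 3) (t c : ℝ) (y v : E3) :
    tangentFlow f i t (y, c • v) =
      ((tangentFlow f i t (y, v)).1, c • (tangentFlow f i t (y, v)).2) := by
  simp [tangentFlow, smul_comm c t]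

theorem tangentStep_smul (τ : Fin 3 → ℝ) (c : ℝ) (y v : E3) :
    tangentStep f τ (y, c • v) =
      ((tangentStep f τ (y, v)).1, c • (tangentStep f τ (y, v)).2) := by
  simp only [tangentStep, tangentFlow_smul]

/-- The differential fixes coordinate i + 2 of a vector and moves the others only proportionally to
it: if the image is zero, so is that coordinate, and then nothing has moved. -/
theorem tangentFlow_snd_ne_zero (i : Fin 3) (t : ℝ) {q : E3 × E3} (hq : q.2 ≠ 0) :
    (tangentFlow f i t q).2 ≠ 0 := by
  intro h
  apply hq
  have h2 : q.2 (i + 2) = 0 := by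
    have := congrArg (fun v : E3 => v (i + 2)) h
    simpa [tangentFlow, liftFieldDeriv_apply] using this
  simpa [tangentFlow, liftFieldDeriv_apply, h2] using h

theorem tangentStep_snd_ne_zero (τ : Fin 3 → ℝ) {q : E3 × E3} (hq : q.2 ≠ 0) :
    (tangentStep f τ q).2 ≠ 0 :=
  tangentFlow_snd_ne_zero _ _ (tangentFlow_snd_ne_zero _ _ (tangentFlow_snd_ne_zero _ _ hq))

/-! ### Projection to the sphere bundle -/

/-- The first basis vector as a point of the sphere. -/
def sphereBase : Metric.sphere (0 : E3) 1 := ⟨basisVec 0, by simp⟩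

/-- The projection of the tangent bundle of the covering space to the sphere bundle. -/
def sphereProj (q : E3 × E3) : ST3 := (proj q.1, normalizeOr sphereBase q.2)

theorem normalizeOr_of_ne {w : E3} (hw : w ≠ 0) (u v : Metric.sphere (0 : E3) 1) :
    normalizeOr u w = normalizeOr v w := by
  simp [normalizeOr, hw]

theorem normalizeOr_smul {c : ℝ} (hc : 0 < c) (u : Metric.sphere (0 : E3) 1) (w : E3) :
    normalizeOr u (c • w) = normalizeOr u w := by
  by_cases hw : w = 0
  · simp [hw]
  · have : c • w ≠ 0 := smul_ne_zero hc.ne' hw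
    simp only [normalizeOr, hw, this, dif_neg, not_false_eq_true]
    ext1
    simp only [norm_smul, mul_inv, smul_smul, Real.norm_eq_abs, abs_of_pos hc]
    congr 1
    field_simp

theorem normalizeOr_coe (u v : Metric.sphere (0 : E3) 1) : normalizeOr u (v : E3) = v := by
  have h1 : ‖(v : E3)‖ = 1 := by simp
  have : (v : E3) ≠ 0 := fun h => by simp [h] at h1
  simp only [normalizeOr, this, dif_neg, not_false_eq_true]
  ext1
  simp [h1]

theorem sphere_ne_zero (u : Metric.sphere (0 : E3) 1) : (u : E3) ≠ 0 := by
  have h1 : ‖(u : E3)‖ = 1 := by simp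
  exact fun h => by simp [h] at h1

theorem sphereProj_coe (y : E3) (u : Metric.sphere (0 : E3) 1) : sphereProj (y, u) = (proj y, u) := by
  simp [sphereProj, normalizeOr_coe]

theorem exists_sphereProj_eq (z : ST3) : ∃ (y : E3) (u : Metric.sphere (0 : E3) 1),
    sphereProj (y, u) = z := by
  obtain ⟨y, hy⟩ := isOpenQuotientMap_proj.surjective z.1
  exact ⟨y, z.2, by rw [sphereProj_coe, hy]⟩

theorem sphereProj_smul {c : ℝ} (hc : 0 < c) (y v : E3) :
    sphereProj (y, c • v) = sphereProj (y, v) := by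
  simp [sphereProj, normalizeOr_smul hc]

theorem continuousOn_sphereProj : ContinuousOn sphereProj {q | q.2 ≠ 0} := by
  refine (isOpenQuotientMap_proj.continuous.comp continuous_fst).continuousOn.prodMk ?_
  rw [continuousOn_iff_continuous_domRestrict]
  have : ({q : E3 × E3 | q.2 ≠ 0}.domRestrict fun q => normalizeOr sphereBase q.2) =
      fun q : {q : E3 × E3 | q.2 ≠ 0} => ⟨‖q.1.2‖⁻¹ • q.1.2, by
        have : q.1.2 ≠ 0 := q.2
        simp [norm_smul, this]⟩ := by
    funext q
    have hq : q.1.2 ≠ 0 := q.2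
    simp [normalizeOr, hq]
  rw [this]
  have hc : Continuous fun q : {q : E3 × E3 | q.2 ≠ 0} => q.1.2 :=
    continuous_snd.comp continuous_subtype_val
  refine Continuous.subtype_mk (Continuous.smul (Continuous.inv₀ hc.norm ?_) hc) _
  intro q
  exact norm_ne_zero_iff.2 q.2

theorem measurable_sphereProj : Measurable sphereProj := by
  refine (isOpenQuotientMap_proj.continuous.comp continuous_fst).measurable.prodMk ?_
  have : Measurable (normalizeOr sphereBase) := by
    have h : Measurable fun w : E3 => ((normalizeOr sphereBase w : Metric.sphere (0 : E3) 1) : E3) := by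
      have : (fun w : E3 => ((normalizeOr sphereBase w : Metric.sphere (0 : E3) 1) : E3)) =
          fun w => open Classical in if w ∈ ({0} : Set E3) then (sphereBase : E3) else ‖w‖⁻¹ • w := by
        funext w
        by_cases hw : w = 0 <;> simp [normalizeOr, hw]
      rw [this]
      exact Measurable.ite (measurableSet_singleton 0) measurable_const (by fun_prop)
    exact h.subtype_mk
  exact this.comp measurable_snd

/-- By homogeneity in the direction, normalising before or after the step is the same. -/
theorem projectiveStep_sphereProj (hf : ∀ i, IsAnalyticOnCircle (f i)) (τ : Fin 3 → ℝ)
    {q : E3 × E3} (hq : q.2 ≠ 0) :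
    projectiveStep f τ (sphereProj q) = sphereProj (tangentStep f τ q) := by
  obtain ⟨y, v⟩ := q
  simp only at hq
  have hv : ((normalizeOr sphereBase v : Metric.sphere (0 : E3) 1) : E3) = ‖v‖⁻¹ • v := by
    simp [normalizeOr, hq]
  have hpos : 0 < ‖v‖⁻¹ := inv_pos.2 (norm_pos_iff.2 hq)
  simp only [projectiveStep, sphereProj, proj_tangentStep, torusFDeriv_step hf, hv,
    tangentStep_smul, normalizeOr_smul hpos]
  rw [normalizeOr_of_ne (tangentStep_snd_ne_zero (q := (y, v)) τ hq)]

/-- Continuity descends from the cover along an open quotient map. It also gives the measurability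
without which `Kernel.map` takes its default value 0. -/
theorem continuous_projectiveStep (hf : ∀ i, IsAnalyticOnCircle (f i)) :
    Continuous fun p : ST3 × (Fin 3 → ℝ) => projectiveStep f p.2 p.1 := by
  have hq : IsOpenQuotientMap (Prod.map (Prod.map proj (id : Metric.sphere (0 : E3) 1 → _))
      (id : (Fin 3 → ℝ) → _)) := (isOpenQuotientMap_proj.prodMap .id).prodMap .id
  rw [← hq.continuous_comp_iff]
  have : (fun p : ST3 × (Fin 3 → ℝ) => projectiveStep f p.2 p.1) ∘
      (Prod.map (Prod.map proj (id : Metric.sphere (0 : E3) 1 → _)) (id : (Fin 3 → ℝ) → _)) =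
      fun p => sphereProj (tangentStep f p.2 (p.1.1, (p.1.2 : E3))) := by
    funext p
    rw [← projectiveStep_sphereProj hf p.2 (q := (p.1.1, (p.1.2 : E3))) (sphere_ne_zero _),
      sphereProj_coe]
    rfl
  rw [this]
  refine continuousOn_sphereProj.comp_continuous ?_
    fun p => tangentStep_snd_ne_zero _ (q := (p.1.1, (p.1.2 : E3))) (sphere_ne_zero _)
  exact (contDiff_tangentStep hf).continuous.comp
    (f := fun p : (E3 × Metric.sphere (0 : E3) 1) × (Fin 3 → ℝ) => (p.2, (p.1.1, (p.1.2 : E3))))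
    (by fun_prop)

end

end RandomSplitting

/-! ### Exponential times and the propagation of minorizations. -/

namespace RandomSplitting

noncomputable section

open scoped ENNReal NNReal Topology ContDiff
open Filter

/-! ### The law of the times -/

theorem le_expMeasure {r : ℝ} (hr : 0 < r) (R : ℝ) :
    ENNReal.ofReal (r * rexp (-(r * R))) • (volume : Measure ℝ).restrict (Ioo 0 R) ≤ expMeasure r := by
  refine Measure.le_iff.2 fun s hs => ?_
  rw [expMeasure, gammaMeasure, withDensity_apply _ hs, Measure.smul_apply, smul_eq_mul,
    Measure.restrict_apply hs, ← setLIntegral_const]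
  calc _ ≤ ∫⁻ x in s ∩ Ioo 0 R, gammaPDF 1 r x := by
        refine setLIntegral_mono_ae' (hs.inter measurableSet_Ioo) (ae_of_all _ fun x hx => ?_)
        change _ ≤ exponentialPDF r x
        rw [exponentialPDF_of_nonneg hx.2.1.le]
        refine ENNReal.ofReal_le_ofReal ?_
        have := hx.2.2.le
        gcongr
    _ ≤ _ := lintegral_mono_set inter_subset_left

/-- The open cube of side `R` of times. -/
def timeBox (R : ℝ) : Set (Fin 3 → ℝ) := Set.pi univ fun _ => Ioo 0 R

theorem isOpen_timeBox (R : ℝ) : IsOpen (timeBox R) := isOpen_set_pi finite_univ fun _ _ => isOpen_Ioo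

theorem mem_closure_timeBox {R : ℝ} {τ : Fin 3 → ℝ} (h0 : ∀ i, 0 ≤ τ i) (hR : ∀ i, τ i < R) :
    τ ∈ closure (timeBox R) := by
  rw [timeBox, closure_pi_set]
  intro i _
  rw [closure_Ioo (((h0 i).trans_lt (hR i)).ne)]
  exact ⟨h0 i, (hR i).le⟩

theorem isProbabilityMeasure_timeLaw {h : ℝ} (hh : 0 < h) : IsProbabilityMeasure (timeLaw h) := by
  have : IsProbabilityMeasure (expMeasure h⁻¹) := isProbabilityMeasure_expMeasure (inv_pos.2 hh)
  unfold timeLaw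
  infer_instance

theorem exists_le_timeLaw {h : ℝ} (hh : 0 < h) (R : ℝ) :
    ∃ c : ℝ≥0∞, 0 < c ∧ c ≠ ⊤ ∧ c • volume.restrict (timeBox R) ≤ timeLaw h := by
  have hr : 0 < h⁻¹ := inv_pos.2 hh
  set c := ENNReal.ofReal (h⁻¹ * rexp (-(h⁻¹ * R))) with hc
  refine ⟨c ^ 3, ENNReal.pow_pos (ENNReal.ofReal_pos.2 (by positivity)) 3, by simp [hc], ?_⟩
  have : IsProbabilityMeasure (expMeasure h⁻¹) := isProbabilityMeasure_expMeasure hr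
  -- `OuterMeasure.pi` is the largest outer measure with the given bounds on boxes, so a comparison
  -- on boxes suffices.
  have key : (c ^ 3 • (volume : Measure (Fin 3 → ℝ)).restrict (timeBox R)).toOuterMeasure ≤
      OuterMeasure.pi fun _ : Fin 3 => (expMeasure h⁻¹).toOuterMeasure := by
    refine OuterMeasure.le_pi.2 fun s _ => ?_
    change (c ^ 3 • (volume : Measure (Fin 3 → ℝ)).restrict (timeBox R)) (pi univ s) ≤ _
    rw [timeBox, volume_pi, Measure.restrict_pi_pi, Measure.smul_apply, Measure.pi_pi, smul_eq_mul]
    have h1 : c ^ 3 = ∏ _i : Fin 3, c := by simp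
    rw [h1, ← Finset.prod_mul_distrib]
    refine Finset.prod_le_prod' fun i _ => ?_
    exact le_expMeasure hr R (s i)
  refine Measure.le_iff.2 fun s hs => ?_
  rw [timeLaw, Measure.pi, toMeasure_apply _ _ hs]
  exact key s

/-- Vanishing times are allowed: τ is then on the boundary of the box, but its neighbourhood O still
meets the open box, where the density is bounded below. -/
theorem timeLaw_pos {h : ℝ} (hh : 0 < h) {O : Set (Fin 3 → ℝ)} (hO : IsOpen O) {τ : Fin 3 → ℝ}
    (hτ : τ ∈ O) (h0 : ∀ i, 0 ≤ τ i) : 0 < timeLaw h O := by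
  set R := ∑ i, τ i + 1
  have hR : ∀ i, τ i < R := fun i => by
    have := Finset.single_le_sum (fun i _ => h0 i) (Finset.mem_univ i)
    simp only [R]; linarith
  obtain ⟨c, hc, -, hle⟩ := exists_le_timeLaw hh R
  refine lt_of_lt_of_le ?_ (hle O)
  rw [Measure.smul_apply, Measure.restrict_apply hO.measurableSet, smul_eq_mul]
  refine ENNReal.mul_pos hc.ne' ?_
  exact ((hO.inter (isOpen_timeBox R)).measure_pos volume
    (mem_closure_iff.1 (mem_closure_timeBox h0 hR) O hO hτ)).ne'

/-! ### The kernel -/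

variable {f : Fin 3 → S1 → ℝ} {h : ℝ}

theorem projectiveKernel_apply (hf : ∀ i, IsAnalyticOnCircle (f i)) (hh : 0 < h) (z : ST3) :
    projectiveKernel f h z = (timeLaw h).map fun τ => projectiveStep f τ z := by
  have := isProbabilityMeasure_timeLaw hh
  have hm := (continuous_projectiveStep hf).measurable
  rw [projectiveKernel, Kernel.map_apply _ hm, Kernel.prod_apply, Kernel.id_apply,
    Kernel.const_apply, Measure.dirac_prod, Measure.map_map hm (by fun_prop)]
  rfl

theorem isMarkovKernel_projectiveKernel (hf : ∀ i, IsAnalyticOnCircle (f i)) (hh : 0 < h) :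
    IsMarkovKernel (projectiveKernel f h) := by
  have := isProbabilityMeasure_timeLaw hh
  exact Kernel.IsMarkovKernel.map _ (continuous_projectiveStep hf).measurable

theorem projectiveKernel_sphereProj (hf : ∀ i, IsAnalyticOnCircle (f i)) (hh : 0 < h)
    {q : E3 × E3} (hq : q.2 ≠ 0) : projectiveKernel f h (sphereProj q) =
      (timeLaw h).map fun τ => sphereProj (tangentStep f τ q) := by
  simp_rw [projectiveKernel_apply hf hh, projectiveStep_sphereProj hf _ hq]

/-! ### Minorized points -/

/-- The `n`-step transition probabilities from the points near `z` dominate a multiple of `ν`. -/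
def IsMinorized (f : Fin 3 → S1 → ℝ) (h : ℝ) (ν : Measure ST3) (n : ℕ) (z : ST3) : Prop :=
  ∃ N ∈ 𝓝 z, ∃ δ : ℝ≥0, 0 < δ ∧ ∀ w ∈ N, δ • ν ≤ (projectiveKernel f h ^ n) w

variable {ν : Measure ST3}

theorem IsMinorized.eventually {n : ℕ} {z : ST3} (hz : IsMinorized f h ν n z) :
    ∀ᶠ w in 𝓝 z, IsMinorized f h ν n w := by
  obtain ⟨N, hN, δ, hδ, H⟩ := hz
  exact (eventually_mem_nhds_iff.2 hN).mono fun w hw => ⟨N, hw, δ, hδ, H⟩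

/-- From every point near z, all times in a neighbourhood of τ lead into the good neighbourhood of
the image; the probability of those times multiplies δ. -/
theorem IsMinorized.of_step (hf : ∀ i, IsAnalyticOnCircle (f i)) (hh : 0 < h) {n : ℕ} {z : ST3}
    {τ : Fin 3 → ℝ} (h0 : ∀ i, 0 ≤ τ i) (hz : IsMinorized f h ν n (projectiveStep f τ z)) :
    IsMinorized f h ν (n + 1) z := by
  obtain ⟨N, hN, δ, hδ, H⟩ := hz
  have := isProbabilityMeasure_timeLaw hh
  have hc := (continuous_projectiveStep hf).continuousAt (x := (z, τ)) |>.preimage_mem_nhds hN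
  rw [nhds_prod_eq, mem_prod_iff] at hc
  obtain ⟨N', hN', O', hO', hsub⟩ := hc
  obtain ⟨O, hOO', hO, hτO⟩ := mem_nhds_iff.1 hO'
  have hpos := timeLaw_pos hh hO hτO h0
  have hfin : timeLaw h O ≠ ⊤ := measure_ne_top _ _
  refine ⟨N', hN', (timeLaw h O).toNNReal * δ, mul_pos (ENNReal.toNNReal_pos hpos.ne' hfin) hδ, ?_⟩
  intro w hw
  refine Measure.le_iff.2 fun A hA => ?_
  have hm : Measurable fun τ => projectiveStep f τ w :=
    ((continuous_projectiveStep hf).comp (Continuous.prodMk_right w)).measurable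
  rw [add_comm, Kernel.pow_add_apply_eq_lintegral _ _ _ _ hA, pow_one, projectiveKernel_apply hf hh,
    lintegral_map (Kernel.measurable_coe _ hA) hm]
  calc _ = ∫⁻ _ in O, δ • ν A ∂(timeLaw h) := by
        rw [setLIntegral_const, Measure.smul_apply, mul_smul, ENNReal.smul_def,
          ENNReal.coe_toNNReal hfin, smul_eq_mul, mul_comm]
    _ ≤ ∫⁻ τ in O, (projectiveKernel f h ^ n) (projectiveStep f τ w) A ∂(timeLaw h) := by
        refine setLIntegral_mono_ae' hO.measurableSet (ae_of_all _ fun τ' hτ' => ?_)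
        exact H _ (hsub (mk_mem_prod hw (hOO' hτ'))) A
    _ ≤ _ := setLIntegral_le_lintegral _ _

theorem projectiveStep_zero (hf : ∀ i, IsAnalyticOnCircle (f i)) (z : ST3) :
    projectiveStep f 0 z = z := by
  obtain ⟨y, u, rfl⟩ := exists_sphereProj_eq z
  rw [projectiveStep_sphereProj hf _ (q := (y, (u : E3))) (sphere_ne_zero u)]
  simp [tangentStep, tangentFlow, baseFlow]

theorem IsMinorized.mono (hf : ∀ i, IsAnalyticOnCircle (f i)) (hh : 0 < h) {n m : ℕ} (hnm : n ≤ m)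
    {z : ST3} (hz : IsMinorized f h ν n z) : IsMinorized f h ν m z := by
  induction m, hnm using Nat.le_induction with
  | base => exact hz
  | succ m _ ih =>
    exact IsMinorized.of_step hf hh (τ := 0) (fun _ => le_rfl) (by rwa [projectiveStep_zero hf])

/-- Compactness is used twice: first for a common exponent, raised by idle steps with zero times,
then for a common constant. -/
theorem exists_le_pow_of_isMinorized (hf : ∀ i, IsAnalyticOnCircle (f i)) (hh : 0 < h)
    (H : ∀ z, ∃ n, IsMinorized f h ν n z) :
    ∃ (n : ℕ) (δ : ℝ≥0), 0 < δ ∧ ∀ z, δ • ν ≤ (projectiveKernel f h ^ n) z := by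
  choose n hn using H
  obtain ⟨t, ht⟩ := CompactSpace.elim_nhds_subcover (fun z => {w | IsMinorized f h ν (n z) w})
    fun z => (hn z).eventually
  have H' : ∀ z, IsMinorized f h ν (t.sup n) z := fun z => by
    have : z ∈ ⋃ x ∈ t, {w | IsMinorized f h ν (n x) w} := ht ▸ mem_univ _
    simp only [mem_iUnion] at this
    obtain ⟨x, hx, hz⟩ := this
    exact IsMinorized.mono hf hh (Finset.le_sup hx) hz
  choose N hN δ hδ hle using H'
  obtain ⟨t', ht'⟩ := CompactSpace.elim_nhds_subcover N hN
  have hne : t'.Nonempty := by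
    by_contra hemp
    rw [Finset.not_nonempty_iff_eq_empty] at hemp
    have : (sphereProj 0 : ST3) ∈ ⋃ x ∈ t', N x := ht' ▸ mem_univ _
    simp [hemp] at this
  refine ⟨t.sup n, t'.inf' hne δ, (Finset.lt_inf'_iff _).2 fun z _ => hδ z, fun z => ?_⟩
  have : z ∈ ⋃ x ∈ t', N x := ht' ▸ mem_univ _
  simp only [mem_iUnion] at this
  obtain ⟨x, hx, hz⟩ := this
  refine le_trans ?_ (hle x z hz)
  intro A
  simp only [Measure.smul_apply]
  have := Finset.inf'_le δ hx
  gcongr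

/-! ### Parametrizations of the iterates by the times -/

variable {Θ : Type*} [NormedAddCommGroup Θ] [NormedSpace ℝ Θ]

/-- The parametrization after one more step. -/
def stepMap (f : Fin 3 → S1 → ℝ) (g : (E3 × E3) × Θ → E3 × E3)
    (x : (E3 × E3) × (Θ × (Fin 3 → ℝ))) : E3 × E3 :=
  tangentStep f x.2.2 (g (x.1, x.2.1))

theorem contDiff_stepMap (hf : ∀ i, IsAnalyticOnCircle (f i))
    {g : (E3 × E3) × Θ → E3 × E3} (hg : ContDiff ℝ ∞ g) : ContDiff ℝ ∞ (stepMap f g) :=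
  (contDiff_tangentStep hf).comp
    (f := fun x : (E3 × E3) × (Θ × (Fin 3 → ℝ)) => (x.2.2, g (x.1, x.2.1))) (by fun_prop)

variable [MeasureSpace Θ]

/-- The map `g` computes the position after `n` steps from the starting point and a parameter of
law `l`, which dominates a multiple of the volume on the open set `O`. -/
structure IsParametrization (f : Fin 3 → S1 → ℝ) (h : ℝ) (n : ℕ) (l : Measure Θ) (O : Set Θ)
    (g : (E3 × E3) × Θ → E3 × E3) : Prop where
  contDiff : ContDiff ℝ ∞ g
  snd_ne_zero : ∀ q θ, q.2 ≠ 0 → (g (q, θ)).2 ≠ 0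
  law : ∀ q, q.2 ≠ 0 → (projectiveKernel f h ^ n) (sphereProj q) = l.map fun θ => sphereProj (g (q, θ))
  isOpen : IsOpen O
  le_law : ∃ c : ℝ≥0∞, 0 < c ∧ c ≠ ⊤ ∧ c • volume.restrict O ≤ l
  prob : IsProbabilityMeasure l

theorem isParametrization_one (hf : ∀ i, IsAnalyticOnCircle (f i)) (hh : 0 < h) (R : ℝ) :
    IsParametrization f h 1 (timeLaw h) (timeBox R) fun x => tangentStep f x.2 x.1 where
  contDiff := (contDiff_tangentStep hf).comp
    (f := fun x : (E3 × E3) × (Fin 3 → ℝ) => (x.2, x.1)) (by fun_prop)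
  snd_ne_zero q θ hq := tangentStep_snd_ne_zero θ hq
  law q hq := by rw [pow_one, projectiveKernel_sphereProj hf hh hq]
  isOpen := isOpen_timeBox R
  le_law := exists_le_timeLaw hh R
  prob := isProbabilityMeasure_timeLaw hh

theorem IsParametrization.measurable_sphereProj [BorelSpace Θ] [SecondCountableTopology Θ]
    {n : ℕ} {l : Measure Θ} {O : Set Θ}
    {g : (E3 × E3) × Θ → E3 × E3} (hg : IsParametrization f h n l O g) (q : E3 × E3) :
    Measurable fun θ => sphereProj (g (q, θ)) :=
  RandomSplitting.measurable_sphereProj.comp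
    (hg.contDiff.continuous.comp (Continuous.prodMk_right q)).measurable

theorem IsParametrization.stepMap [BorelSpace Θ] [SecondCountableTopology Θ]
    [SigmaFinite (volume : Measure Θ)]
    (hf : ∀ i, IsAnalyticOnCircle (f i)) (hh : 0 < h) {n : ℕ} {l : Measure Θ} {O : Set Θ}
    {g : (E3 × E3) × Θ → E3 × E3} (hg : IsParametrization f h n l O g) (R : ℝ) :
    IsParametrization f h (n + 1) (l.prod (timeLaw h)) (O ×ˢ timeBox R) (stepMap f g) := by
  have := hg.prob
  have := isProbabilityMeasure_timeLaw hh
  have hcd := contDiff_stepMap hf hg.contDiff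
  refine ⟨hcd, fun q θ hq => tangentStep_snd_ne_zero _ (hg.snd_ne_zero q θ.1 hq), ?_,
    hg.isOpen.prod (isOpen_timeBox R), ?_, inferInstance⟩
  · intro q hq
    ext A hA
    have hm : Measurable fun θ => sphereProj (RandomSplitting.stepMap f g (q, θ)) :=
      RandomSplitting.measurable_sphereProj.comp (hcd.continuous.comp (Continuous.prodMk_right q)).measurable
    rw [Kernel.pow_succ_apply_eq_lintegral _ _ _ hA, hg.law q hq,
      lintegral_map (Kernel.measurable_coe _ hA) (hg.measurable_sphereProj q),
      Measure.map_apply hm hA, Measure.prod_apply (hm hA)]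
    refine lintegral_congr fun θ => ?_
    have hm' : Measurable fun τ => sphereProj (tangentStep f τ (g (q, θ))) :=
      RandomSplitting.measurable_sphereProj.comp ((contDiff_tangentStep hf).continuous.comp
        (Continuous.prodMk_left (g (q, θ)))).measurable
    rw [projectiveKernel_sphereProj hf hh (hg.snd_ne_zero q θ hq), Measure.map_apply hm' hA]
    rfl
  · obtain ⟨c, hc, hct, hle⟩ := hg.le_law
    obtain ⟨c', hc', hct', hle'⟩ := exists_le_timeLaw hh R
    refine ⟨c * c', ENNReal.mul_pos hc.ne' hc'.ne', ENNReal.mul_ne_top hct hct', ?_⟩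
    refine le_trans (le_of_eq ?_) (Measure.prod_mono hle hle')
    rw [Measure.prod_smul_left, Measure.prod_smul_right, Measure.prod_restrict, smul_smul]
    rfl

end

end RandomSplitting

/-! ### Derivatives of the lifted chain with respect to the times. -/

namespace RandomSplitting

noncomputable section

open scoped ENNReal NNReal Topology ContDiff
open Filter

variable {f : Fin 3 → S1 → ℝ} {h : ℝ}

/-! ### Velocities with respect to the times -/

variable (f) in
/-- The generator of the tangent flow of `Xᵢ`. -/
def flowVelocity (i : Fin 3) (q : E3 × E3) : E3 × E3 :=
  (liftField f i q.1, liftFieldDeriv f i q.1 q.2)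

variable (f) in
/-- The differential of the tangent flow of `Xᵢ` at time `t`. -/
def tangentFlowDeriv (i : Fin 3) (t : ℝ) (q w : E3 × E3) : E3 × E3 :=
  (w.1 + t • liftFieldDeriv f i q.1 w.1,
    w.2 + t • (liftFieldDeriv f i q.1 w.2 + (q.2 (i + 2) * w.1 (i + 2)) •
      (deriv (deriv (lift f i)) (q.1 (i + 2)) • basisVec i +
        deriv (deriv (deriv (lift f i))) (q.1 (i + 2)) • basisVec (i + 1))))

theorem hasDerivAt_tangentFlow (hf : ∀ i, IsAnalyticOnCircle (f i)) (i : Fin 3) {t : ℝ → ℝ}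
    {t' s : ℝ} (ht : HasDerivAt t t' s) {c : ℝ → E3 × E3} {w : E3 × E3} (hc : HasDerivAt c w s) :
    HasDerivAt (fun r => tangentFlow f i (t r) (c r))
      (tangentFlowDeriv f i (t s) (c s) w + t' • flowVelocity f i (c s)) s := by
  have h1 : HasDerivAt (fun r => (c r).1) w.1 s :=
    (ContinuousLinearMap.fst ℝ E3 E3).hasFDerivAt.comp_hasDerivAt s hc
  have h2 : HasDerivAt (fun r => (c r).2) w.2 s :=
    (ContinuousLinearMap.snd ℝ E3 E3).hasFDerivAt.comp_hasDerivAt s hc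
  have h1' : HasDerivAt (fun r => (c r).1 (i + 2)) (w.1 (i + 2)) s :=
    (EuclideanSpace.proj (i + 2) : E3 →L[ℝ] ℝ).hasFDerivAt.comp_hasDerivAt s h1
  have h2' : HasDerivAt (fun r => (c r).2 (i + 2)) (w.2 (i + 2)) s :=
    (EuclideanSpace.proj (i + 2) : E3 →L[ℝ] ℝ).hasFDerivAt.comp_hasDerivAt s h2
  have k1 : HasDerivAt (fun r => deriv (lift f i) ((c r).1 (i + 2))) _ s :=
    (((contDiff_deriv_lift hf i).differentiable (by simp)).differentiableAt.hasDerivAt).comp s h1'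
  have k2 : HasDerivAt (fun r => deriv (deriv (lift f i)) ((c r).1 (i + 2))) _ s :=
    (((contDiff_deriv_deriv_lift hf i).differentiable (by simp)).differentiableAt.hasDerivAt).comp s h1'
  have k0 := (hasFDerivAt_liftField hf i (c s).1).comp_hasDerivAt s h1
  have e1 := h1.add (ht.smul k0)
  have e2 := h2.add (ht.smul (h2'.smul ((k1.smul_const (basisVec i)).add
    (k2.smul_const (basisVec (i + 1))))))
  have e3 := (e1.prodMk e2).congr_of_eventuallyEq
    (f₁ := fun r => tangentFlow f i (t r) (c r)) (Eventually.of_forall fun r => by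
      simp [tangentFlow, baseFlow, liftFieldDeriv_apply])
  refine e3.congr_deriv ?_
  simp only [tangentFlowDeriv, flowVelocity, liftFieldDeriv_apply, Function.comp_apply, Prod.smul_mk,
    Prod.mk_add_mk]
  congr 1
  · module
  · simp only [Pi.add_apply, Pi.smul_apply']
    module

variable {Θ : Type*} [NormedAddCommGroup Θ] [NormedSpace ℝ Θ]

/-- The image of the partial differential of `g` with respect to the parameter. -/
def velocities (g : (E3 × E3) × Θ → E3 × E3) (q : E3 × E3) (θ : Θ) : Submodule ℝ (E3 × E3) :=
  LinearMap.range ((fderiv ℝ g (q, θ)).comp (ContinuousLinearMap.inr ℝ (E3 × E3) Θ) :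
    Θ →ₗ[ℝ] E3 × E3)

theorem hasDerivAt_line {g : (E3 × E3) × Θ → E3 × E3} {q : E3 × E3} {θ : Θ}
    (hg : DifferentiableAt ℝ g (q, θ)) (t : Θ) :
    HasDerivAt (fun s : ℝ => g (q, θ + s • t)) (fderiv ℝ g (q, θ) (0, t)) 0 := by
  have hl : HasDerivAt (fun s : ℝ => (q, θ + s • t)) ((0 : E3 × E3), t) 0 := by
    have : HasDerivAt (fun s : ℝ => θ + s • t) t 0 := by
      simpa using ((hasDerivAt_id (0 : ℝ)).smul_const t).const_add θ
    exact (hasDerivAt_const _ _).prodMk this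
  have hg' : HasFDerivAt g (fderiv ℝ g (q, θ)) (q, θ + (0 : ℝ) • t) := by
    simpa using hg.hasFDerivAt
  exact hg'.comp_hasDerivAt (0 : ℝ) hl

theorem mem_velocities_of_hasDerivAt {g : (E3 × E3) × Θ → E3 × E3} {q : E3 × E3} {θ : Θ}
    (hg : DifferentiableAt ℝ g (q, θ)) {t : Θ} {w : E3 × E3}
    (hw : HasDerivAt (fun s : ℝ => g (q, θ + s • t)) w 0) : w ∈ velocities g q θ :=
  ⟨t, by simpa using (hasDerivAt_line hg t).unique hw⟩

theorem exists_hasDerivAt_of_mem_velocities {g : (E3 × E3) × Θ → E3 × E3} {q : E3 × E3} {θ : Θ}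
    (hg : DifferentiableAt ℝ g (q, θ)) {w : E3 × E3} (hw : w ∈ velocities g q θ) :
    ∃ t, HasDerivAt (fun s : ℝ => g (q, θ + s • t)) w 0 := by
  obtain ⟨t, rfl⟩ := hw
  exact ⟨t, by simpa using hasDerivAt_line hg t⟩

variable (f) in
/-- The velocity of `tangentStep` when the point moves with velocity `w` and the times with
velocity `a`. -/
def tangentStepVelocity (τ a : Fin 3 → ℝ) (q w : E3 × E3) : E3 × E3 :=
  tangentFlowDeriv f 2 (τ 2) (tangentFlow f 1 (τ 1) (tangentFlow f 0 (τ 0) q))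
    (tangentFlowDeriv f 1 (τ 1) (tangentFlow f 0 (τ 0) q)
      (tangentFlowDeriv f 0 (τ 0) q w + a 0 • flowVelocity f 0 q) +
        a 1 • flowVelocity f 1 (tangentFlow f 0 (τ 0) q)) +
    a 2 • flowVelocity f 2 (tangentFlow f 1 (τ 1) (tangentFlow f 0 (τ 0) q))

theorem hasDerivAt_tangentStep (hf : ∀ i, IsAnalyticOnCircle (f i)) (τ a : Fin 3 → ℝ)
    {c : ℝ → E3 × E3} {q w : E3 × E3} (hc : HasDerivAt c w 0) (hq : c 0 = q) :
    HasDerivAt (fun s : ℝ => tangentStep f (τ + s • a) (c s)) (tangentStepVelocity f τ a q w) 0 := by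
  have ht : ∀ j, HasDerivAt (fun s : ℝ => (τ + s • a) j) (a j) 0 := fun j => by
    simpa using ((hasDerivAt_id (0 : ℝ)).mul_const (a j)).const_add (τ j)
  have := hasDerivAt_tangentFlow hf 2 (ht 2)
    (hasDerivAt_tangentFlow hf 1 (ht 1) (hasDerivAt_tangentFlow hf 0 (ht 0) hc))
  simpa [tangentStepVelocity, tangentStep, hq] using this

/-- A velocity attained so far is transported by the next step, whose own three times contribute
further velocities. This allows the rank to be computed step by step. -/
theorem tangentStepVelocity_mem_stepMap (hf : ∀ i, IsAnalyticOnCircle (f i))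
    {g : (E3 × E3) × Θ → E3 × E3} (hg : ContDiff ℝ ∞ g) {q z w : E3 × E3} {θ : Θ}
    (hz : g (q, θ) = z) (hw : w ∈ velocities g q θ) (τ a : Fin 3 → ℝ) :
    tangentStepVelocity f τ a z w ∈ velocities (stepMap f g) q (θ, τ) := by
  obtain ⟨t, ht⟩ := exists_hasDerivAt_of_mem_velocities (hg.differentiable (by simp)).differentiableAt hw
  refine mem_velocities_of_hasDerivAt (t := (t, a))
    ((contDiff_stepMap hf hg).differentiable (by simp)).differentiableAt ?_
  exact hasDerivAt_tangentStep hf τ a ht (by simpa using hz)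

theorem tangentStepVelocity_mem (hf : ∀ i, IsAnalyticOnCircle (f i)) (q : E3 × E3)
    (τ a : Fin 3 → ℝ) : tangentStepVelocity f τ a q 0 ∈
      velocities (fun x : (E3 × E3) × (Fin 3 → ℝ) => tangentStep f x.2 x.1) q τ := by
  refine mem_velocities_of_hasDerivAt (t := a) ?_
    (hasDerivAt_tangentStep hf τ a (hasDerivAt_const (0 : ℝ) q) rfl)
  exact (((contDiff_tangentStep hf).comp (f := fun x : (E3 × E3) × (Fin 3 → ℝ) => (x.2, x.1))
    (by fun_prop)).differentiable (by simp)).differentiableAt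

theorem tangentFlow_zero (i : Fin 3) (q : E3 × E3) : tangentFlow f i 0 q = q := by
  simp [tangentFlow, baseFlow]

theorem tangentFlowDeriv_zero (i : Fin 3) (q w : E3 × E3) : tangentFlowDeriv f i 0 q w = w := by
  simp [tangentFlowDeriv]

/-! ### Points over common critical points -/

/-- The coordinates of `y` are critical points of the functions, where the functions and their
second and third derivatives take the values `p`, `k` and `r`. -/
structure IsCritical (f : Fin 3 → S1 → ℝ) (p k r : Fin 3 → ℝ) (y : E3) : Prop where
  lift_eq : ∀ i, lift f i (y (i + 2)) = p i
  deriv_eq : ∀ i, deriv (lift f i) (y (i + 2)) = 0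
  deriv2_eq : ∀ i, deriv (deriv (lift f i)) (y (i + 2)) = k i
  deriv3_eq : ∀ i, deriv (deriv (deriv (lift f i))) (y (i + 2)) = r i

theorem deriv_deriv_deriv_lift (i : Fin 3) (s : ℝ) :
    circleDeriv (circleDeriv (circleDeriv (f i))) (s : S1) = deriv (deriv (deriv (lift f i))) s := by
  rw [circleDeriv_coe]
  congr 1
  funext r
  exact circleDeriv_circleDeriv_lift f i r

theorem IsCritical.of_proj_eq {p k r : Fin 3 → ℝ} {y y' : E3} (hy : IsCritical f p k r y)
    (hp : proj y' = proj y) : IsCritical f p k r y' := by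
  have hc : ∀ i, ((y' i : ℝ) : S1) = (y i : ℝ) := fun i => congrFun hp i
  refine ⟨fun i => ?_, fun i => ?_, fun i => ?_, fun i => ?_⟩
  · rw [← hy.lift_eq i, lift, lift, hc]
  · rw [← hy.deriv_eq i, ← circleDeriv_lift, ← circleDeriv_lift, hc]
  · rw [← hy.deriv2_eq i, ← circleDeriv_circleDeriv_lift, ← circleDeriv_circleDeriv_lift, hc]
  · rw [← hy.deriv3_eq i, ← deriv_deriv_deriv_lift, ← deriv_deriv_deriv_lift, hc]

variable {p k r : Fin 3 → ℝ} {y : E3}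

theorem IsCritical.liftField_eq (hy : IsCritical f p k r y) (i : Fin 3) :
    liftField f i y = p i • basisVec i := by
  rw [liftField, hy.lift_eq, hy.deriv_eq, zero_smul, add_zero]

theorem IsCritical.liftFieldDeriv_apply (hy : IsCritical f p k r y) (i : Fin 3) (v : E3) :
    liftFieldDeriv f i y v = (v (i + 2) * k i) • basisVec (i + 1) := by
  rw [RandomSplitting.liftFieldDeriv_apply, hy.deriv_eq, hy.deriv2_eq, zero_smul, zero_add, smul_smul]

/-- As the first derivative vanishes, the base point moves along coordinate i alone and the
differential is an elementary shear. These shears are the controls used for directions. -/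
theorem IsCritical.tangentFlow_eq (hy : IsCritical f p k r y) (i : Fin 3) (t : ℝ) (u : E3) :
    tangentFlow f i t (y, u) =
      (y + (t * p i) • basisVec i, u + (t * (u (i + 2) * k i)) • basisVec (i + 1)) := by
  simp only [tangentFlow, baseFlow, hy.liftField_eq, hy.liftFieldDeriv_apply, smul_smul]

theorem IsCritical.flowVelocity_eq (hy : IsCritical f p k r y) (i : Fin 3) (u : E3) :
    flowVelocity f i (y, u) = (p i • basisVec i, (u (i + 2) * k i) • basisVec (i + 1)) := by
  simp only [flowVelocity, hy.liftField_eq, hy.liftFieldDeriv_apply]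

theorem IsCritical.tangentFlowDeriv_eq (hy : IsCritical f p k r y) (i : Fin 3) (t : ℝ) (u : E3)
    (w : E3 × E3) : tangentFlowDeriv f i t (y, u) w =
      (w.1 + (t * (w.1 (i + 2) * k i)) • basisVec (i + 1),
        w.2 + t • ((w.2 (i + 2) * k i) • basisVec (i + 1) + (u (i + 2) * w.1 (i + 2)) •
          (k i • basisVec i + r i • basisVec (i + 1)))) := by
  simp only [tangentFlowDeriv, hy.liftFieldDeriv_apply, hy.deriv2_eq, hy.deriv3_eq, smul_smul]

theorem proj_smul_basisVec {s : ℝ} (hs : (s : S1) = 0) (i : Fin 3) : proj (s • basisVec i) = 0 := by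
  funext j
  by_cases hj : j = i
  · subst hj; simp [proj, hs]
  · simp [proj, hj]

theorem proj_add_smul_basisVec {s : ℝ} (hs : (s : S1) = 0) (i : Fin 3) (y : E3) :
    proj (y + s • basisVec i) = proj y := by
  rw [proj_add, proj_smul_basisVec hs, add_zero]

theorem IsCritical.add (hy : IsCritical f p k r y) {s : ℝ} (hs : (s : S1) = 0) (i : Fin 3) :
    IsCritical f p k r (y + s • basisVec i) :=
  hy.of_proj_eq (proj_add_smul_basisVec hs i y)

end

end RandomSplitting

/-! ### The rank computation and the minorization near one point. -/

namespace RandomSplitting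

noncomputable section

open scoped ENNReal NNReal Topology ContDiff
open Filter

variable {f : Fin 3 → S1 → ℝ} {h : ℝ}

/-- A tangent vector of the tangent bundle, by its coordinates. -/
def tv (a b c a' b' c' : ℝ) : E3 × E3 := (!₂[a, b, c], !₂[a', b', c'])

theorem tv_eta (w : E3 × E3) : w = tv (w.1 0) (w.1 1) (w.1 2) (w.2 0) (w.2 1) (w.2 2) := by
  ext j <;> fin_cases j <;> simp [tv]

theorem tv_zero : tv 0 0 0 0 0 0 = 0 := by
  ext j <;> fin_cases j <;> simp [tv]

theorem add_tv (a b c a' b' c' x y z x' y' z' : ℝ) : tv a b c a' b' c' + tv x y z x' y' z' =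
    tv (a + x) (b + y) (c + z) (a' + x') (b' + y') (c' + z') := by
  ext j <;> fin_cases j <;> simp [tv]

theorem smul_tv (s a b c a' b' c' : ℝ) :
    s • tv a b c a' b' c' = tv (s * a) (s * b) (s * c) (s * a') (s * b') (s * c') := by
  ext j <;> fin_cases j <;> simp [tv]

/-- The system is triangular: h₆ fixes fibre coordinate 0, then h₃ base coordinate 2, h₄ and h₅ base
coordinates 0 and 1, and h₁, h₂ absorb the rest. -/
theorem eq_top_of_tv_mem {S : Submodule ℝ (E3 × E3)} {p₀ p₁ p₂ s α β γ δ ε : ℝ}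
    (hp₀ : p₀ ≠ 0) (hp₁ : p₁ ≠ 0) (hs : s ≠ 0) (hε : ε ≠ 0)
    (h₁ : tv 0 0 0 0 1 0 ∈ S) (h₂ : tv 0 0 0 0 0 1 ∈ S) (h₃ : tv p₀ 0 s 0 α β ∈ S)
    (h₄ : tv p₀ 0 0 0 γ 0 ∈ S) (h₅ : tv 0 p₁ 0 0 0 δ ∈ S) (h₆ : tv 0 0 p₂ ε 0 0 ∈ S) : S = ⊤ := by
  refine Submodule.eq_top_iff'.2 fun w => ?_
  set x₆ := w.2 0 / ε with hx₆
  set x₃ := (w.1 2 - x₆ * p₂) / s with hx₃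
  set x₄ := w.1 0 / p₀ - x₃ with hx₄
  set x₅ := w.1 1 / p₁ with hx₅
  have := S.add_mem (S.add_mem (S.add_mem (S.smul_mem (w.2 1 - x₃ * α - x₄ * γ) h₁)
    (S.smul_mem (w.2 2 - x₃ * β - x₅ * δ) h₂)) (S.add_mem (S.smul_mem x₃ h₃) (S.smul_mem x₄ h₄)))
    (S.add_mem (S.smul_mem x₅ h₅) (S.smul_mem x₆ h₆))
  simp only [smul_tv, add_tv] at this
  convert this using 1
  refine (tv_eta w).trans ?_
  congr 1
  · rw [hx₄]; field_simp; ring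
  · rw [hx₅]; field_simp; ring
  · rw [hx₃]; field_simp; ring
  · rw [hx₆]; field_simp; ring
  · ring
  · ring

variable {p k r : Fin 3 → ℝ} {y : E3}

theorem IsCritical.tangentStep_one (hy : IsCritical f p k r y) (T a b c : ℝ) :
    tangentStep f ![0, T, 0] (y, !₂[a, b, c]) =
      (y + (T * p 1) • basisVec 1, !₂[a, b, c + T * (a * k 1)]) := by
  simp only [tangentStep, Matrix.cons_val_zero, Matrix.cons_val_one, Matrix.cons_val,
    tangentFlow_zero]
  rw [hy.tangentFlow_eq]
  congr 1
  ext j; fin_cases j <;> simp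

theorem IsCritical.tangentStep_zero (hy : IsCritical f p k r y) (T a b c : ℝ) :
    tangentStep f ![T, 0, 0] (y, !₂[a, b, c]) =
      (y + (T * p 0) • basisVec 0, !₂[a, b + T * (c * k 0), c]) := by
  simp only [tangentStep, Matrix.cons_val_zero, Matrix.cons_val_one, Matrix.cons_val,
    tangentFlow_zero]
  rw [hy.tangentFlow_eq]
  congr 1
  ext j; fin_cases j <;> simp

theorem IsCritical.tangentStepVelocity_one (hy : IsCritical f p k r y) {T : ℝ}
    (hT : ((T * p 1 : ℝ) : S1) = 0) (α : Fin 3 → ℝ) (a b c x₀ x₁ x₂ v₀ v₁ v₂ : ℝ) :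
    tangentStepVelocity f ![0, T, 0] α (y, !₂[a, b, c]) (tv x₀ x₁ x₂ v₀ v₁ v₂) =
      tv (x₀ + α 0 * p 0) (x₁ + α 1 * p 1) (x₂ + T * (x₀ + α 0 * p 0) * k 1 + α 2 * p 2)
        (v₀ + α 2 * (b * k 2)) (v₁ + α 0 * (c * k 0) + T * a * (x₀ + α 0 * p 0) * k 1)
        (v₂ + T * (v₀ * k 1 + a * (x₀ + α 0 * p 0) * r 1) + α 1 * (a * k 1)) := by
  have hy' := hy.add hT 1
  simp only [tangentStepVelocity, Matrix.cons_val_zero, Matrix.cons_val_one, Matrix.cons_val,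
    tangentFlow_zero, tangentFlowDeriv_zero]
  simp only [hy.flowVelocity_eq, hy.tangentFlow_eq, hy.tangentFlowDeriv_eq, hy'.flowVelocity_eq]
  ext j <;> fin_cases j <;> simp [tv] <;> ring

theorem IsCritical.tangentStepVelocity_zero (hy : IsCritical f p k r y) {T : ℝ}
    (hT : ((T * p 0 : ℝ) : S1) = 0) (α : Fin 3 → ℝ) (a b c x₀ x₁ x₂ v₀ v₁ v₂ : ℝ) :
    tangentStepVelocity f ![T, 0, 0] α (y, !₂[a, b, c]) (tv x₀ x₁ x₂ v₀ v₁ v₂) =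
      tv (x₀ + α 0 * p 0) (x₁ + T * x₂ * k 0 + α 1 * p 1) (x₂ + α 2 * p 2)
        (v₀ + T * c * x₂ * k 0 + α 2 * ((b + T * (c * k 0)) * k 2))
        (v₁ + T * (v₂ * k 0 + c * x₂ * r 0) + α 0 * (c * k 0)) (v₂ + α 1 * (a * k 1)) := by
  have hy' := hy.add hT 0
  simp only [tangentStepVelocity, Matrix.cons_val_zero, Matrix.cons_val_one, Matrix.cons_val,
    tangentFlow_zero, tangentFlowDeriv_zero]
  simp only [hy.flowVelocity_eq, hy.tangentFlow_eq, hy.tangentFlowDeriv_eq, hy'.flowVelocity_eq]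
  ext j <;> fin_cases j <;> simp [tv] <;> ring

/-- The position after four steps as a function of the starting point and the times. -/
abbrev fourStepMap (f : Fin 3 → S1 → ℝ) :
    (E3 × E3) × ((((Fin 3 → ℝ) × (Fin 3 → ℝ)) × (Fin 3 → ℝ)) × (Fin 3 → ℝ)) → E3 × E3 :=
  stepMap f (stepMap f (stepMap f fun x => tangentStep f x.2 x.1))

theorem velocities_fourStepMap (hf : ∀ i, IsAnalyticOnCircle (f i)) (hy : IsCritical f p k r y)
    (hp : ∀ i, p i ≠ 0) (hk : ∀ i, k i ≠ 0) {T₀ T₁ : ℝ} (hT₀ : T₀ ≠ 0) (hT₁ : T₁ ≠ 0)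
    (h₀ : ((T₀ * p 0 : ℝ) : S1) = 0) (h₁ : ((T₁ * p 1 : ℝ) : S1) = 0) :
    velocities (fourStepMap f) (y, !₂[1, 0, 0])
      (((![0, T₁, 0], ![T₀, 0, 0]), ![0, T₁, 0]), ![0, 0, 0]) = ⊤ := by
  have c₁ : ContDiff ℝ ∞ fun x : (E3 × E3) × (Fin 3 → ℝ) => tangentStep f x.2 x.1 :=
    (contDiff_tangentStep hf).comp (f := fun x : (E3 × E3) × (Fin 3 → ℝ) => (x.2, x.1)) (by fun_prop)
  have c₂ := contDiff_stepMap hf c₁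
  have c₃ := contDiff_stepMap hf c₂
  have yA := hy.add h₁ 1
  have yB := yA.add h₀ 0
  have yC := yB.add h₁ 1
  have zA := hy.tangentStep_one T₁ 1 0 0
  have zB := yA.tangentStep_zero T₀ 1 0 (0 + T₁ * (1 * k 1))
  have zC := yB.tangentStep_one T₁ 1 (0 + T₀ * ((0 + T₁ * (1 * k 1)) * k 0)) (0 + T₁ * (1 * k 1))
  have rA := tangentStepVelocity_mem hf (y, !₂[1, 0, 0]) ![0, T₁, 0]
  have rB := fun {w : E3 × E3} (hw : w ∈ velocities _ _ _) =>
    tangentStepVelocity_mem_stepMap hf c₁ (q := (y, !₂[1, 0, 0])) (θ := ![0, T₁, 0]) zA hw ![T₀, 0, 0]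
  rw [← zA] at zB
  have rC := fun {w : E3 × E3} (hw : w ∈ velocities _ _ _) =>
    tangentStepVelocity_mem_stepMap hf c₂ (q := (y, !₂[1, 0, 0])) (θ := (![0, T₁, 0], ![T₀, 0, 0]))
      zB hw ![0, T₁, 0]
  rw [← zB] at zC
  have rD := fun {w : E3 × E3} (hw : w ∈ velocities _ _ _) =>
    tangentStepVelocity_mem_stepMap hf c₃ (q := (y, !₂[1, 0, 0]))
      (θ := ((![0, T₁, 0], ![T₀, 0, 0]), ![0, T₁, 0])) zC hw ![0, 0, 0]
  rw [← tv_zero] at rA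
  have a₁ := rA ![0, 1, 0]
  rw [hy.tangentStepVelocity_one h₁] at a₁
  -- Time of field 1 is shifted from after to before the loop of field 0. The base displacements
  -- cancel and only the failure to commute remains, a purely vertical vector along fibre coordinate
  -- 1.
  have b₁ := rB a₁ ![0, -1, 0]
  rw [yA.tangentStepVelocity_zero h₀] at b₁
  have b₂ := rB (tv_zero ▸ Submodule.zero_mem _) ![0, 0, 1]
  rw [yA.tangentStepVelocity_zero h₀] at b₂
  have b₃ := rB (tv_zero ▸ Submodule.zero_mem _) ![1, 0, 0]
  rw [yA.tangentStepVelocity_zero h₀] at b₃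
  have d₁ := rC b₁ ![0, 0, 0]
  rw [yB.tangentStepVelocity_one h₁] at d₁
  -- The same device for field 2 around the second loop of field 1; what remains is vertical along
  -- fibre coordinate 2.
  have d₂ := rC b₂ ![0, 0, -1]
  rw [yB.tangentStepVelocity_one h₁] at d₂
  have d₃ := rC b₃ ![0, 0, 0]
  rw [yB.tangentStepVelocity_one h₁] at d₃
  -- The last step has zero times, the case T = 0 of the same formula: it keeps earlier velocities
  -- and adds those of the three fields at the end point.
  have h0' : (((0 : ℝ) * p 1 : ℝ) : S1) = 0 := by simp
  have e₁ := rD d₁ ![0, 0, 0]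
  rw [yC.tangentStepVelocity_one h0'] at e₁
  have e₂ := rD d₂ ![0, 0, 0]
  rw [yC.tangentStepVelocity_one h0'] at e₂
  have e₃ := rD d₃ ![0, 0, 0]
  rw [yC.tangentStepVelocity_one h0'] at e₃
  have e₄ := rD (tv_zero ▸ Submodule.zero_mem _) ![1, 0, 0]
  rw [yC.tangentStepVelocity_one h0'] at e₄
  have e₅ := rD (tv_zero ▸ Submodule.zero_mem _) ![0, 1, 0]
  rw [yC.tangentStepVelocity_one h0'] at e₅
  have e₆ := rD (tv_zero ▸ Submodule.zero_mem _) ![0, 0, 1]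
  rw [yC.tangentStepVelocity_one h0'] at e₆
  simp at e₁ e₂ e₃ e₄ e₅ e₆
  have hk₀ := hk 0
  have hk₁ := hk 1
  have hk₂ := hk 2
  have f₁ := Submodule.smul_mem _ (T₀ * (k 1 * k 0))⁻¹ e₁
  have f₂ := Submodule.smul_mem _ (T₁ * (T₀ * (T₁ * k 1 * k 0) * k 2 * k 1))⁻¹ e₂
  rw [smul_tv, inv_mul_cancel₀ (by positivity)] at f₁ f₂
  simp only [mul_zero] at f₁ f₂
  exact eq_top_of_tv_mem (hp 0) (hp 1) (mul_ne_zero (mul_ne_zero hT₁ (hp 0)) hk₁)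
    (by positivity) f₁ f₂ e₃ e₄ e₅ e₆

theorem isAddHaarMeasure_volume_prod {A B : Type*} [NormedAddCommGroup A] [MeasureSpace A]
    [BorelSpace A] [SecondCountableTopology A] [SigmaFinite (volume : Measure A)]
    [(volume : Measure A).IsAddHaarMeasure]
    [NormedAddCommGroup B] [MeasureSpace B] [BorelSpace B] [SecondCountableTopology B]
    [SigmaFinite (volume : Measure B)] [(volume : Measure B).IsAddHaarMeasure] :
    (volume : Measure (A × B)).IsAddHaarMeasure :=
  Measure.prod.instIsAddHaarMeasure volume volume

theorem coe_abs_div_mul {a : ℝ} (ha : a ≠ 0) : ((2 * π / |a| * a : ℝ) : S1) = 0 := by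
  rcases abs_cases a with ⟨h, -⟩ | ⟨h, -⟩
  · rw [h, div_mul_cancel₀ _ ha, AddCircle.coe_period]
  · rw [h, div_mul_eq_mul_div, mul_div_assoc, div_neg, div_self ha, mul_neg_one, AddCircle.coe_neg,
      AddCircle.coe_period, neg_zero]

/-- The four-step transition probabilities from near a point over critical points dominate a
nonzero measure. -/
theorem exists_isMinorized (hf : ∀ i, IsAnalyticOnCircle (f i)) (hh : 0 < h)
    (hy : IsCritical f p k r y) (hp : ∀ i, p i ≠ 0) (hk : ∀ i, k i ≠ 0) :
    ∃ ν : Measure ST3, IsFiniteMeasure ν ∧ ν ≠ 0 ∧ IsMinorized f h ν 4 (proj y, sphereBase) := by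
  set T₀ := 2 * π / |p 0|
  set T₁ := 2 * π / |p 1|
  have hT₀ : 0 < T₀ := div_pos Real.two_pi_pos (abs_pos.2 (hp 0))
  have hT₁ : 0 < T₁ := div_pos Real.two_pi_pos (abs_pos.2 (hp 1))
  set R := T₀ + T₁ + 1
  have hpar := (((isParametrization_one hf hh R).stepMap hf hh R).stepMap hf hh R).stepMap hf hh R
  set g := fourStepMap f
  set θ : (((Fin 3 → ℝ) × (Fin 3 → ℝ)) × (Fin 3 → ℝ)) × (Fin 3 → ℝ) :=
    (((![0, T₁, 0], ![T₀, 0, 0]), ![0, T₁, 0]), ![0, 0, 0])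
  have hvel : velocities g (y, !₂[1, 0, 0]) θ = ⊤ :=
    velocities_fourStepMap hf hy hp hk hT₀.ne' hT₁.ne' (coe_abs_div_mul (hp 0)) (coe_abs_div_mul (hp 1))
  have hstrict : HasStrictFDerivAt g (fderiv ℝ g ((y, !₂[1, 0, 0]), θ)) ((y, !₂[1, 0, 0]), θ) :=
    hpar.contDiff.contDiffAt.hasStrictFDerivAt (by simp)
  have hsurj : ∀ w, ∃ t, fderiv ℝ g ((y, !₂[1, 0, 0]), θ) (0, t) = w := fun w => by
    obtain ⟨t, ht⟩ : w ∈ velocities g (y, !₂[1, 0, 0]) θ := hvel ▸ Submodule.mem_top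
    exact ⟨t, by simpa using ht⟩
  -- Most of the times in θ are zero, so θ lies only in the closure of the open box.
  have hθ : θ ∈ closure (((timeBox R ×ˢ timeBox R) ×ˢ timeBox R) ×ˢ timeBox R) := by
    rw [closure_prod_eq, closure_prod_eq, closure_prod_eq]
    refine ⟨⟨⟨?_, ?_⟩, ?_⟩, ?_⟩ <;> refine mem_closure_timeBox (fun i => ?_) (fun i => ?_) <;>
      fin_cases i <;> simp [θ, R] <;> linarith
  have i₂ : (volume : Measure ((Fin 3 → ℝ) × (Fin 3 → ℝ))).IsAddHaarMeasure :=
    isAddHaarMeasure_volume_prod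
  have i₃ : (volume : Measure (((Fin 3 → ℝ) × (Fin 3 → ℝ)) × (Fin 3 → ℝ))).IsAddHaarMeasure :=
    isAddHaarMeasure_volume_prod
  have i₄ : (volume : Measure ((((Fin 3 → ℝ) × (Fin 3 → ℝ)) × (Fin 3 → ℝ)) ×
      (Fin 3 → ℝ))).IsAddHaarMeasure := isAddHaarMeasure_volume_prod
  have iE : (volume : Measure (E3 × E3)).IsAddHaarMeasure := isAddHaarMeasure_volume_prod
  obtain ⟨N, hN, δ, hδ, hδt, w, ρ, hρ, hmain⟩ := exists_le_measure_inter_preimage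
    (volume : Measure ((((Fin 3 → ℝ) × (Fin 3 → ℝ)) × (Fin 3 → ℝ)) × (Fin 3 → ℝ)))
    (volume : Measure (E3 × E3)) hpar.contDiff.continuous hstrict hsurj hpar.isOpen hθ
  obtain ⟨c, hc, hct, hle⟩ := hpar.le_law
  have hm := RandomSplitting.measurable_sphereProj
  -- The ball is independent of the starting point, hence so is its image ν in the sphere bundle.
  refine ⟨(volume.restrict (Metric.ball w ρ)).map sphereProj, ?_, ?_, ?_⟩
  · have : IsFiniteMeasure (volume.restrict (Metric.ball w ρ)) :=
      ⟨by simpa using measure_ball_lt_top⟩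
    infer_instance
  · intro h0
    have := congrArg (fun μ => μ univ) h0
    simp only [Measure.map_apply hm .univ, preimage_univ, Measure.restrict_apply_univ,
      Measure.coe_zero, Pi.zero_apply] at this
    exact (Metric.measure_ball_pos _ _ hρ).ne' this
  · have hbase : ((sphereBase : Metric.sphere (0 : E3) 1) : E3) = !₂[1, 0, 0] := by
      ext j; fin_cases j <;> simp [sphereBase]
    have hN' : (fun x : E3 × Metric.sphere (0 : E3) 1 => ((x.1, (x.2 : E3)) : E3 × E3)) ⁻¹' N ∈
        𝓝 (y, sphereBase) := by
      refine ContinuousAt.preimage_mem_nhds (by fun_prop) ?_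
      simpa [hbase] using hN
    have hopen : IsOpenMap (Prod.map proj (id : Metric.sphere (0 : E3) 1 → _)) :=
      (isOpenQuotientMap_proj.prodMap .id).isOpenMap
    refine ⟨_, hopen.image_mem_nhds hN', (c * δ).toNNReal,
      ENNReal.toNNReal_pos (ENNReal.mul_pos hc.ne' hδ.ne').ne' (ENNReal.mul_ne_top hct hδt), ?_⟩
    rintro _ ⟨⟨y', u'⟩, hyu, rfl⟩
    have hyu' : (y', (u' : E3)) ∈ N := hyu
    refine Measure.le_iff.2 fun A hA => ?_
    have hlaw := hpar.law (y', (u' : E3)) (sphere_ne_zero u')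
    rw [sphereProj_coe] at hlaw
    change _ ≤ (projectiveKernel f h ^ 4) (proj y', u') A
    rw [hlaw, Measure.map_apply (hpar.measurable_sphereProj _) hA]
    refine le_trans ?_ (hle _)
    have hmain' := hmain _ hyu' (sphereProj ⁻¹' A ∩ Metric.ball w ρ) inter_subset_right
      ((hm hA).inter Metric.isOpen_ball.measurableSet)
    rw [Measure.smul_apply, Measure.smul_apply, Measure.map_apply hm hA, Measure.restrict_apply (hm hA),
      Measure.restrict_apply (hpar.measurable_sphereProj _ hA), ENNReal.smul_def,
      ENNReal.coe_toNNReal (ENNReal.mul_ne_top hct hδt), smul_eq_mul, smul_eq_mul, mul_assoc]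
    gcongr
    refine hmain'.trans (measure_mono ?_)
    rintro t ⟨ht, ht'⟩
    exact ⟨ht'.1, ht⟩

end

end RandomSplitting

/-! ### Nondegenerate critical points and steering of directions by loops. -/

namespace RandomSplitting

noncomputable section

open scoped ENNReal NNReal Topology ContDiff
open Filter

variable {f : Fin 3 → S1 → ℝ} {h : ℝ} {ν : Measure ST3}

/-! ### Critical points -/

theorem continuous_of_isAnalyticOnCircle {g : S1 → ℝ} (hg : IsAnalyticOnCircle g) : Continuous g := by
  rw [← (QuotientAddGroup.isOpenQuotientMap_mk (G := ℝ)).continuous_comp_iff]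
  exact (hg.contDiff (n := 0)).continuous

/-- A positive second derivative would make the point a local minimum as well, so g would be locally
constant and its second derivative zero. -/
theorem deriv_deriv_neg_of_isLocalMax {g : ℝ → ℝ} {s : ℝ} (hc : ContinuousAt g s)
    (hg : IsLocalMax g s) (h2 : deriv (deriv g) s ≠ 0) : deriv (deriv g) s < 0 := by
  by_contra! hle
  have hmin := isLocalMin_of_deriv_deriv_pos (lt_of_le_of_ne hle h2.symm) hg.deriv_eq_zero hc
  have heq : g =ᶠ[𝓝 s] fun _ => g s := by
    filter_upwards [hg, hmin] with r h₁ h₂ using le_antisymm h₁ h₂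
  have := heq.deriv.deriv_eq
  simp at this
  exact h2 this

theorem exists_critical_neg {g : S1 → ℝ} (hg : IsAnalyticOnCircle g)
    (h1 : zeroSet (circleDeriv g) ∩ zeroSet (circleDeriv (circleDeriv g)) = ∅) :
    ∃ θ, circleDeriv g θ = 0 ∧ circleDeriv (circleDeriv g) θ < 0 := by
  obtain ⟨θ, -, hθ⟩ := isCompact_univ.exists_isMaxOn univ_nonempty
    (continuous_of_isAnalyticOnCircle hg).continuousOn
  obtain ⟨s, rfl⟩ := QuotientAddGroup.mk_surjective θ
  have hmax : IsLocalMax (fun r : ℝ => g (r : S1)) s :=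
    Eventually.of_forall fun r => hθ (mem_univ _)
  have e1 := circleDeriv_coe g s
  have e2 : circleDeriv (circleDeriv g) (s : S1) = deriv (deriv fun r : ℝ => g (r : S1)) s := by
    rw [circleDeriv_coe]
    congr 1
    funext r
    exact circleDeriv_coe g r
  have h0 : circleDeriv g (s : S1) = 0 := by rw [e1]; exact hmax.deriv_eq_zero
  refine ⟨s, h0, ?_⟩
  have hne : circleDeriv (circleDeriv g) (s : S1) ≠ 0 := fun h2 => by
    have : (s : S1) ∈ zeroSet (circleDeriv g) ∩ zeroSet (circleDeriv (circleDeriv g)) := ⟨h0, h2⟩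
    rw [h1] at this
    exact this
  rw [e2] at hne ⊢
  exact deriv_deriv_neg_of_isLocalMax (hg.contDiff (n := 0)).continuous.continuousAt hmax hne

theorem circleDeriv_neg (g : S1 → ℝ) : circleDeriv (-g) = -circleDeriv g := by
  funext θ
  simp [circleDeriv, deriv.fun_neg]

theorem exists_critical_pos {g : S1 → ℝ} (hg : IsAnalyticOnCircle g)
    (h1 : zeroSet (circleDeriv g) ∩ zeroSet (circleDeriv (circleDeriv g)) = ∅) :
    ∃ θ, circleDeriv g θ = 0 ∧ 0 < circleDeriv (circleDeriv g) θ := by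
  obtain ⟨θ, h2, h3⟩ := exists_critical_neg (g := -g) (fun s hs => (hg s hs).neg) (by
    simpa [circleDeriv_neg, zeroSet] using h1)
  simp only [circleDeriv_neg, Pi.neg_apply, neg_eq_zero, neg_lt_zero] at h2 h3
  exact ⟨θ, h2, h3⟩

theorem isCritical_of_proj_eq {x : T3} {y : E3} (hx : ∀ i, circleDeriv (f i) (x (i + 2)) = 0)
    (hy : proj y = x) : IsCritical f (fun i => f i (x (i + 2)))
      (fun i => circleDeriv (circleDeriv (f i)) (x (i + 2)))
      (fun i => circleDeriv (circleDeriv (circleDeriv (f i))) (x (i + 2))) y := by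
  subst hy
  refine ⟨fun i => rfl, fun i => ?_, fun i => ?_, fun i => ?_⟩
  · rw [← hx i, ← circleDeriv_lift]; rfl
  · rw [← circleDeriv_circleDeriv_lift]; rfl
  · rw [← deriv_deriv_deriv_lift]; rfl

/-! ### Accessibility -/

/-- Some iterate of the kernel is minorized near the projection of `q`. -/
def IsAcc (f : Fin 3 → S1 → ℝ) (h : ℝ) (ν : Measure ST3) (q : E3 × E3) : Prop :=
  ∃ n, IsMinorized f h ν n (sphereProj q)

theorem IsAcc.of_tangentFlow (hf : ∀ i, IsAnalyticOnCircle (f i)) (hh : 0 < h) (i : Fin 3) {t : ℝ}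
    (ht : 0 ≤ t) {q : E3 × E3} (hq : q.2 ≠ 0) (H : IsAcc f h ν (tangentFlow f i t q)) :
    IsAcc f h ν q := by
  obtain ⟨n, hn⟩ := H
  refine ⟨n + 1, IsMinorized.of_step hf hh (τ := Pi.single i t) (fun j => ?_) ?_⟩
  · by_cases hj : j = i
    · subst hj; simpa using ht
    · simp [hj]
  · rw [projectiveStep_sphereProj hf _ hq]
    convert hn using 2
    fin_cases i <;> simp [tangentStep, tangentFlow_zero]

/-- Running forward reaches every point of a circle: choose the representative of d with the sign of
a. -/
theorem exists_time {a : ℝ} (ha : a ≠ 0) (d : S1) : ∃ t : ℝ, 0 ≤ t ∧ ((t * a : ℝ) : S1) = d := by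
  rcases lt_or_gt_of_ne ha with ha' | ha'
  · have h1 := (AddCircle.equivIoc (2 * π) (-(2 * π)) d).2
    refine ⟨(AddCircle.equivIoc (2 * π) (-(2 * π)) d : ℝ) / a,
      div_nonneg_of_nonpos (by linarith [h1.2]) ha'.le, ?_⟩
    rw [div_mul_cancel₀ _ ha, AddCircle.coe_equivIoc]
  · have h1 := (AddCircle.equivIoc (2 * π) 0 d).2
    refine ⟨(AddCircle.equivIoc (2 * π) 0 d : ℝ) / a, div_nonneg h1.1.le ha'.le, ?_⟩
    rw [div_mul_cancel₀ _ ha, AddCircle.coe_equivIoc]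

variable {p k r : Fin 3 → ℝ} {y : E3}

theorem IsAcc.of_smul {c : ℝ} (hc : 0 < c) {y v : E3} (H : IsAcc f h ν (y, c • v)) :
    IsAcc f h ν (y, v) := by
  rwa [IsAcc, sphereProj_smul hc] at H

theorem IsAcc.congr_proj {y y' v : E3} (hy : proj y = proj y') (H : IsAcc f h ν (y, v)) :
    IsAcc f h ν (y', v) := by
  rwa [IsAcc, sphereProj, hy] at H

/-- Loops along the flow of `Xᵢ` at a critical point. -/
theorem IsAcc.of_loops (hf : ∀ i, IsAnalyticOnCircle (f i)) (hh : 0 < h) (hy : IsCritical f p k r y)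
    {i : Fin 3} (hp : p i ≠ 0) (n : ℕ) {u : E3} (hu : u ≠ 0)
    (H : IsAcc f h ν (y, u + (n * (2 * π / |p i|) * (u (i + 2) * k i)) • basisVec (i + 1))) :
    IsAcc f h ν (y, u) := by
  refine IsAcc.of_tangentFlow hf hh i (t := n * (2 * π / |p i|)) (by positivity) hu ?_
  rw [hy.tangentFlow_eq]
  refine H.congr_proj (proj_add_smul_basisVec ?_ i y).symm
  rw [mul_assoc, ← nsmul_eq_mul, AddCircle.coe_nsmul, coe_abs_div_mul hp, smul_zero]

/-- Each loop of field 2 adds the same positive multiple of e₀ to u, so the normalised direction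
tends to e₀, and being minorized is an open condition. -/
theorem IsAcc.of_pos (hf : ∀ i, IsAnalyticOnCircle (f i)) (hh : 0 < h) (hy : IsCritical f p k r y)
    (hp : ∀ i, p i ≠ 0) (H : IsAcc f h ν (y, basisVec 0)) {u : E3} (hu : 0 < u 1 * k 2) :
    IsAcc f h ν (y, u) := by
  have hu0 : u ≠ 0 := by rintro rfl; simp at hu
  obtain ⟨m, hm⟩ := H
  set s := 2 * π / |p 2| * (u 1 * k 2) with hs
  have hs0 : 0 < s := mul_pos (div_pos Real.two_pi_pos (abs_pos.2 (hp 2))) hu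
  have hlim : Tendsto (fun n : ℕ => (y, ((n : ℝ) + 1)⁻¹ • u + (((n : ℝ) + 1)⁻¹ * ((n : ℝ) + 1) * s) • basisVec 0))
      atTop (𝓝 (y, (0 : ℝ) • u + (1 * s) • basisVec 0)) := by
    have h1 : Tendsto (fun n : ℕ => ((n : ℝ) + 1)⁻¹) atTop (𝓝 0) := by
      simpa using tendsto_one_div_add_atTop_nhds_zero_nat (𝕜 := ℝ)
    have h2 : Tendsto (fun n : ℕ => ((n : ℝ) + 1)⁻¹ * ((n : ℝ) + 1)) atTop (𝓝 1) := by
      refine tendsto_const_nhds.congr fun n => ?_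
      rw [inv_mul_cancel₀ (by positivity)]
    exact tendsto_const_nhds.prodMk_nhds ((h1.smul_const u).add ((h2.mul_const s).smul_const _))
  have hne : (0 : ℝ) • u + (1 * s) • basisVec 0 ≠ 0 := by
    rw [zero_smul, zero_add, one_mul]
    exact smul_ne_zero hs0.ne' (by simp)
  have hcont : ContinuousAt sphereProj (y, (0 : ℝ) • u + (1 * s) • basisVec 0) :=
    continuousOn_sphereProj.continuousAt
      ((isOpen_ne.preimage continuous_snd).mem_nhds hne)
  have hm' : IsMinorized f h ν m (sphereProj (y, (0 : ℝ) • u + (1 * s) • basisVec 0)) := by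
    rw [zero_smul, zero_add, one_mul, sphereProj_smul hs0]
    exact hm
  obtain ⟨n, hn⟩ := ((hcont.tendsto.comp hlim).eventually hm'.eventually).exists
  refine IsAcc.of_loops hf hh hy (hp 2) (n + 1) hu0 ?_
  refine IsAcc.of_smul (c := ((n : ℝ) + 1)⁻¹) (by positivity) ⟨m, ?_⟩
  convert hn using 3
  rw [smul_add, smul_smul, hs]
  push_cast
  rw [show (2 : Fin 3) + 2 = 1 from rfl, Function.comp_apply, mul_assoc, mul_assoc]

end

end RandomSplitting

/-! ### Accessibility from the whole sphere bundle. -/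

namespace RandomSplitting

noncomputable section

open scoped ENNReal NNReal Topology ContDiff
open Filter

variable {f : Fin 3 → S1 → ℝ} {h : ℝ} {ν : Measure ST3} {p k r p' k' r' : Fin 3 → ℝ} {y : E3}

theorem IsAcc.of_move (hf : ∀ i, IsAnalyticOnCircle (f i)) (hh : 0 < h) (hy : IsCritical f p k r y)
    {i : Fin 3} (hp : p i ≠ 0) (d : S1) {u : E3} (hu : u ≠ 0)
    (H : ∀ y' u', proj y' = Function.update (proj y) i d → (∀ j ≠ i + 1, u' j = u j) → u' ≠ 0 →
      IsAcc f h ν (y', u')) : IsAcc f h ν (y, u) := by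
  obtain ⟨t, ht, htd⟩ := exists_time hp (d - proj y i)
  refine IsAcc.of_tangentFlow hf hh i ht hu ?_
  have hne := tangentFlow_snd_ne_zero (f := f) i t (q := (y, u)) hu
  rw [hy.tangentFlow_eq] at hne ⊢
  refine H _ _ ?_ (fun j hj => by simp [hj]) hne
  rw [proj_add]
  funext j
  by_cases hj : j = i
  · subst hj
    have : proj ((t * p j) • basisVec j) j = d - proj y j := by
      rw [← htd]; simp [proj]
    simp [this]
  · simp [hj, proj]

theorem exists_nat_mul_add_pos {s : ℝ} (hs : 0 < s) (c : ℝ) : ∃ n : ℕ, 0 < c + n * s := by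
  obtain ⟨n, hn⟩ := exists_nat_gt (-c / s)
  exact ⟨n, by rw [div_lt_iff₀ hs] at hn; linarith⟩

/-- Loops of field 0 add positive multiples of `u 2 * k 0` to `u 1`; under the sign condition enough
of them make `u 1 * k 2` positive. -/
theorem IsAcc.of_sign (hf : ∀ i, IsAnalyticOnCircle (f i)) (hh : 0 < h) (hy : IsCritical f p k r y)
    (hp : ∀ i, p i ≠ 0) {u : E3} (hs : 0 < u 2 * k 0 * k 2)
    (H : ∀ u' : E3, 0 < u' 1 * k 2 → IsAcc f h ν (y, u')) : IsAcc f h ν (y, u) := by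
  have hu0 : u ≠ 0 := by rintro rfl; simp at hs
  obtain ⟨n, hn⟩ := exists_nat_mul_add_pos
    (mul_pos (div_pos Real.two_pi_pos (abs_pos.2 (hp 0))) hs) (u 1 * k 2)
  refine IsAcc.of_loops hf hh hy (hp 0) n hu0 (H _ ?_)
  convert hn using 1
  simp
  ring

/-- If `u 2` has the wrong sign for the loops of field 0 at x, field 2 carries the point to third
coordinate d, where `k' 0` has the other sign. The loops are done there and field 2 leads back; both
moves alter only `u 0`. Directions with `u 2 = 0` are first sheared out of that plane. -/
theorem IsAcc.of_ne_zero (hf : ∀ i, IsAnalyticOnCircle (f i)) (hh : 0 < h) {x : T3} {d : S1}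
    (hx : ∀ y, proj y = x → IsCritical f p k r y)
    (hx' : ∀ y, proj y = Function.update x 2 d → IsCritical f p' k' r' y)
    (hp : ∀ i, p i ≠ 0) (hp' : ∀ i, p' i ≠ 0) (hk : ∀ i, k i ≠ 0) (hkk : k' 2 = k 2)
    (hk0 : k' 0 * k 0 < 0) (H : ∀ y, proj y = x → IsAcc f h ν (y, basisVec 0))
    (hy : proj y = x) {u : E3} (hu : u ≠ 0) : IsAcc f h ν (y, u) := by
  have G1 : ∀ y, proj y = x → ∀ u : E3, 0 < u 1 * k 2 → IsAcc f h ν (y, u) := fun y hy u hu =>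
    IsAcc.of_pos hf hh (hx y hy) hp (H y hy) hu
  have G1' : ∀ y, proj y = Function.update x 2 d → ∀ u : E3, 0 < u 1 * k' 2 → IsAcc f h ν (y, u) := by
    intro y hy u hu
    refine IsAcc.of_move hf hh (hx' y hy) (hp' 2) (x 2) (by rintro rfl; simp at hu)
      fun y' u' h1 h2 _ => G1 y' ?_ u' ?_
    · rw [h1, hy]; simp
    · rwa [h2 1 (by decide), ← hkk]
  have G2 : ∀ y, proj y = x → ∀ u : E3, u 2 ≠ 0 → IsAcc f h ν (y, u) := by
    intro y hy u hu
    have hne : u ≠ 0 := by rintro rfl; simp at hu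
    rcases lt_or_gt_of_ne (mul_ne_zero (mul_ne_zero hu (hk 0)) (hk 2)) with hs | hs
    · refine IsAcc.of_move hf hh (hx y hy) (hp 2) d hne fun y' u' h1 h2 _ => ?_
      rw [hy] at h1
      refine IsAcc.of_sign hf hh (hx' y' h1) hp' ?_ (G1' y' h1)
      rw [h2 2 (by decide), hkk]
      by_contra! hle
      have h3 := mul_nonneg_of_nonpos_of_nonpos hs.le hle
      have h4 : 0 < (u 2 * k 2) ^ 2 := by have := hk 2; positivity
      nlinarith [mul_neg_of_pos_of_neg h4 hk0]
    · exact IsAcc.of_sign hf hh (hx y hy) hp hs (G1 y hy)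
  have G3 : ∀ y, proj y = x → ∀ u : E3, u 0 ≠ 0 → IsAcc f h ν (y, u) := by
    intro y hy u hu
    by_cases h2 : u 2 = 0
    · refine IsAcc.of_loops hf hh (hx y hy) (hp 1) 1 (by rintro rfl; simp at hu) (G2 y hy _ ?_)
      have := hk 1
      have := hp 1
      have := Real.pi_ne_zero
      simp [*]
    · exact G2 y hy u h2
  by_cases h0 : u 0 = 0
  · by_cases h1 : u 1 = 0
    · refine G2 y hy u fun h2 => hu ?_
      ext j; fin_cases j <;> assumption
    -- One loop of field 2 turns a nonzero `u 1` into a nonzero `u 0`; a loop of field 1 then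
    -- reaches `u 2`.
    · refine IsAcc.of_loops hf hh (hx y hy) (hp 2) 1 hu (G3 y hy _ ?_)
      have := hk 2
      have := hp 2
      have := Real.pi_ne_zero
      simp [*]
  · exact G3 y hy u h0

/-- Every tangent direction at `x` is accessible. -/
def IsAccOver (f : Fin 3 → S1 → ℝ) (h : ℝ) (ν : Measure ST3) (x : T3) : Prop :=
  ∀ y u, proj y = x → u ≠ 0 → IsAcc f h ν (y, u)

theorem IsAccOver.of_flow (hf : ∀ i, IsAnalyticOnCircle (f i)) (hh : 0 < h) (i : Fin 3) {t : ℝ}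
    (ht : 0 ≤ t) {x : T3} (H : IsAccOver f h ν (flow f i t x)) : IsAccOver f h ν x := by
  intro y u hy hu
  refine IsAcc.of_tangentFlow hf hh i ht hu ?_
  have hne := tangentFlow_snd_ne_zero (f := f) i t (q := (y, u)) hu
  exact H _ _ (by rw [← hy, ← proj_baseFlow]) hne

theorem flow_apply_add_two (i : Fin 3) (t : ℝ) (x : T3) : flow f i t x (i + 2) = x (i + 2) := by
  fin_cases i <;> simp [flow, vectorField, proj]

theorem flow_apply_self (i : Fin 3) (t : ℝ) (x : T3) :
    flow f i t x i = x i + ((t * f i (x (i + 2)) : ℝ) : S1) := by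
  fin_cases i <;> simp [flow, vectorField, proj]

theorem flow_apply_add_one (i : Fin 3) (t : ℝ) (x : T3) :
    flow f i t x (i + 1) = x (i + 1) + ((t * circleDeriv (f i) (x (i + 2)) : ℝ) : S1) := by
  fin_cases i <;> simp [flow, vectorField, proj]

theorem IsAccOver.of_apply_self (hf : ∀ i, IsAnalyticOnCircle (f i)) (hh : 0 < h) (i : Fin 3) {x : T3}
    (hx : f i (x (i + 2)) ≠ 0) (d : S1)
    (H : ∀ x' : T3, x' i = d → x' (i + 2) = x (i + 2) →
      (circleDeriv (f i) (x (i + 2)) = 0 → x' (i + 1) = x (i + 1)) → IsAccOver f h ν x') :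
    IsAccOver f h ν x := by
  obtain ⟨t, ht, htd⟩ := exists_time hx (d - x i)
  refine IsAccOver.of_flow hf hh i ht (H _ ?_ (flow_apply_add_two i t x) fun h0 => ?_)
  · rw [flow_apply_self, htd]; simp
  · rw [flow_apply_add_one, h0]; simp

theorem IsAccOver.of_apply_add_one (hf : ∀ i, IsAnalyticOnCircle (f i)) (hh : 0 < h) (i : Fin 3)
    {x : T3} (hx : circleDeriv (f i) (x (i + 2)) ≠ 0) (d : S1)
    (H : ∀ x' : T3, x' (i + 1) = d → IsAccOver f h ν x') : IsAccOver f h ν x := by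
  obtain ⟨t, ht, htd⟩ := exists_time hx (d - x (i + 1))
  refine IsAccOver.of_flow hf hh i ht (H _ ?_)
  rw [flow_apply_add_one, htd]; simp

/-- Once a coordinate is critical, the field reading it has nonzero speed and adjusts its own
coordinate without disturbing the next. If `x 2` is critical, fields 0, 1, 2 in turn reach c.
Otherwise field 0 can bring coordinate 1 to `c 1`, and fields 2 and 0 finish. -/
theorem isAccOver (hf : ∀ i, IsAnalyticOnCircle (f i)) (hh : 0 < h)
    (h1 : ∀ i s, circleDeriv (f i) s = 0 → f i s ≠ 0) {c : T3}
    (hc : ∀ i, circleDeriv (f i) (c (i + 2)) = 0) (H : IsAccOver f h ν c) (x : T3) :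
    IsAccOver f h ν x := by
  have c0 : circleDeriv (f 0) (c 2) = 0 := hc 0
  have c1 : circleDeriv (f 1) (c 0) = 0 := hc 1
  have c2 : circleDeriv (f 2) (c 1) = 0 := hc 2
  by_cases h0 : circleDeriv (f 0) (x 2) = 0
  · refine IsAccOver.of_apply_self hf hh 0 (h1 0 _ h0) (c 0) fun x₁ e₁ _ _ => ?_
    have e₁' : circleDeriv (f 1) (x₁ 0) = 0 := by rw [e₁]; exact c1
    refine IsAccOver.of_apply_self hf hh 1 (h1 1 _ e₁') (c 1) fun x₂ e₂ e₃ _ => ?_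
    have e₂' : circleDeriv (f 2) (x₂ 1) = 0 := by rw [e₂]; exact c2
    refine IsAccOver.of_apply_self hf hh 2 (h1 2 _ e₂') (c 2) fun x₃ e₄ e₅ e₆ => ?_
    convert H
    funext j
    fin_cases j
    · exact (e₆ e₂').trans (e₃.trans e₁)
    · exact e₅.trans e₂
    · exact e₄
  · refine IsAccOver.of_apply_add_one hf hh 0 h0 (c 1) fun x₁ e₁ => ?_
    have e₁' : circleDeriv (f 2) (x₁ 1) = 0 := by rw [← zero_add 1, e₁]; exact c2
    refine IsAccOver.of_apply_self hf hh 2 (h1 2 _ e₁') (c 2) fun x₂ e₂ e₃ _ => ?_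
    have e₂' : circleDeriv (f 0) (x₂ 2) = 0 := by rw [e₂]; exact c0
    refine IsAccOver.of_apply_self hf hh 0 (h1 0 _ e₂') (c 0) fun x₃ e₄ e₅ e₆ => ?_
    convert H
    funext j
    fin_cases j
    · exact e₄
    · exact (e₆ e₂').trans (e₃.trans e₁)
    · exact e₅.trans e₂

theorem exists_isAccOver (hf : ∀ i, IsAnalyticOnCircle (f i)) (h1 : H1 f) (hh : 0 < h) :
    ∃ ν : Measure ST3, IsFiniteMeasure ν ∧ ν ≠ 0 ∧ ∀ x, IsAccOver f h ν x := by
  have hp : ∀ i s, circleDeriv (f i) s = 0 → f i s ≠ 0 := fun i s h2 h3 =>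
    ((h1 i).1.subset ⟨h3, h2⟩ : s ∈ (∅ : Set RandomSplitting.S1))
  have hk : ∀ i s, circleDeriv (f i) s = 0 → circleDeriv (circleDeriv (f i)) s ≠ 0 :=
    fun i s h2 h3 => ((h1 i).2.subset ⟨h2, h3⟩ : s ∈ (∅ : Set RandomSplitting.S1))
  -- Only `f 0` needs critical points of both curvatures; for the other two any critical point will
  -- do.
  obtain ⟨m, m1, m2⟩ := exists_critical_pos (hf 0) (h1 0).2
  obtain ⟨m', m1', m2'⟩ := exists_critical_neg (hf 0) (h1 0).2
  obtain ⟨a, ha, -⟩ := exists_critical_pos (hf 1) (h1 1).2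
  obtain ⟨b, hb, -⟩ := exists_critical_pos (hf 2) (h1 2).2
  set c : T3 := ![a, b, m] with hcdef
  have hc : ∀ i, circleDeriv (f i) (c (i + 2)) = 0 := by
    intro i; fin_cases i
    · exact m1
    · exact ha
    · exact hb
  have hc' : ∀ i, circleDeriv (f i) (Function.update c 2 m' (i + 2)) = 0 := by
    intro i; fin_cases i
    · exact m1'
    · exact ha
    · exact hb
  obtain ⟨y, hy⟩ := isOpenQuotientMap_proj.surjective c
  obtain ⟨ν, h2, h3, h4⟩ := exists_isMinorized hf hh (isCritical_of_proj_eq hc hy)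
    (fun i => hp i _ (hc i)) (fun i => hk i _ (hc i))
  refine ⟨ν, h2, h3, isAccOver hf hh hp hc fun y' u hy' hu => ?_⟩
  refine IsAcc.of_ne_zero hf hh (d := m') (fun y hy => isCritical_of_proj_eq hc hy)
    (fun y hy => isCritical_of_proj_eq hc' hy) (fun i => hp i _ (hc i)) (fun i => hp i _ (hc' i))
    (fun i => hk i _ (hc i)) rfl (mul_neg_of_neg_of_pos m2' m2) (fun y'' hy'' => ⟨4, ?_⟩) hy' hu
  rw [← hy] at hy''
  rw [← hy''] at h4
  exact (sphereProj_coe y'' sphereBase).symm ▸ h4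

end

end RandomSplitting

/-- Uniform geometric ergodicity of the projective chain. -/
theorem mainTheorem7 (f : Fin 3 → RandomSplitting.S1 → ℝ)
    (hf_analytic : ∀ i, RandomSplitting.IsAnalyticOnCircle (f i))
    (hf_nonconst : ∀ i, ¬ ∃ c : ℝ, ∀ θ, f i θ = c)
    (hf_H1 : RandomSplitting.H1 f) (h : ℝ) (hh : 0 < h) :
    RandomSplitting.IsUniformlyGeometricallyErgodic (RandomSplitting.projectiveKernel f h) := by
  obtain ⟨ν, hν, hν0, H⟩ := RandomSplitting.exists_isAccOver hf_analytic hf_H1 hh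
  obtain ⟨n, δ, hδ, hle⟩ := RandomSplitting.exists_le_pow_of_isMinorized (ν := ν) hf_analytic hh
    fun z => by
      obtain ⟨y, u, rfl⟩ := RandomSplitting.exists_sphereProj_eq z
      exact H _ y u rfl (RandomSplitting.sphere_ne_zero u)
  have := RandomSplitting.isMarkovKernel_projectiveKernel hf_analytic hh
  have : Nonempty RandomSplitting.ST3 := ⟨RandomSplitting.sphereProj 0⟩
  exact RandomSplitting.isUniformlyGeometricallyErgodic_of_le _ hle (by simp [hδ.ne', hν0])
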